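/- Let $\gamma\sim\mathcal N(0,1)$. For a measurable function $\sigma:\mathbb R\to\mathbb R$, $0<a\le b<\infty$ and $q>0$, define \[ s_\sigma(a,b):=\sup_{s\in[a,b]}\frac{\mathbb E[\sigma(s\gamma)^2]}{(\mathbb E[\sigma(s\gamma)])^2},\qquad \kappa_{\sigma,q}(a,b):=\inf_{s\in[a,b]}\frac{|\mathbb E[\sigma(s\gamma)]|}{s^q}. \] For a nonzero real matrix $A$ let $\mathrm{st}(A):=\|A\|_F^2/\|A\|_{\mathrm{op}}^2$ be its stable rank. For every $p\ge 1$ there is a constant $c=c(p)>0$, depending only on $p$, such that the following holds. Let $m,d,n\ge 1$, let $X=[x_1,\dots,x_n]\in\mathbb R^{d\times n}$ be a fixed matrix with nonzero columns, and let $W\in\mathbb R^{m\times d}$ have i.i.d. $\mathcal N(0,\tfrac1d)$ entries. Let $\sigma:\mathbb R\to\mathbb R$ be measurable with $\sigma(0)=0$ and $|\sigma(t)|\le L_\sigma|t|^p$ for all $t\in\mathbb R$, where $L_\sigma<\infty$, and let $A=\sigma(WX)\in\mathbb R^{m\times n}$, with $\sigma$ applied entrywise. Set \[ a:=\frac1{\sqrt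 d}\min_{1\le t\le n}\|x_t\|_2,\qquad b:=\frac1{\sqrt d}\max_{1\le t\le n}\|x_t\|_2, \] let $q>0$ satisfy $\kappa_{\sigma,q}(a,b)>0$, and put \[ r:=\frac{L_\sigma}{\kappa_{\sigma,q}(a,b)}\cdot\sup_{s\in[a,b]}s^{p-q}. \] Then for all $0<\varepsilon_1\le 1$ and $0<\varepsilon_2<1$, with probability at least \[ 1-2\exp\Big(-c\min\big\{m\varepsilon_2^2r^{-2},\ m^{\min\{1,2/p\}}\varepsilon_2^{2/p}r^{-2/p}\big\}\Big) -2\exp\Big(-c\min\big\{m\varepsilon_1^2r^{-4},\ m^{\min\{1,1/p\}}\varepsilon_1^{1/p}r^{-2/p}\big\}\Big), \] the matrix $A$ is nonzero and \[ \mathrm{st}(A)\le\frac{1+\varepsilon_1}{(1-\varepsilon_2)^2}\,s_\sigma(a,b). \] Moreover, for the ReLU activation $\sigma(t)=\max\{t,0\}$ one has $s_\sigma(a,b)=\pi$ for all $0<a\le b<\infty$. -/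

import Mathlib

open MeasureTheory ProbabilityTheory

noncomputable section

/-- The Frobenius norm `‖A‖_F` of a real matrix. -/
def frobNorm {m n : ℕ} (A : Matrix (Fin m) (Fin n) ℝ) : ℝ :=
  letI := Matrix.frobeniusNormedAddCommGroup (m := Fin m) (n := Fin n) (α := ℝ)
  ‖A‖

/-- The operator norm `‖A‖_op` of a real matrix with respect to the Euclidean norms. -/
def opNorm {m n : ℕ} (A : Matrix (Fin m) (Fin n) ℝ) : ℝ :=
  letI := Matrix.instL2OpNormedAddCommGroup (m := Fin m) (n := Fin n) (𝕜 := ℝ)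
  ‖A‖

/-- The stable rank `st(A) = ‖A‖_F² / ‖A‖_op²` (meaningful for `A ≠ 0`). -/
def stableRank {m n : ℕ} (A : Matrix (Fin m) (Fin n) ℝ) : ℝ :=
  frobNorm A ^ 2 / opNorm A ^ 2

/-- The post-activation matrix `σ(WX)`, with `σ` applied entrywise. -/
def postActivation {m d n : ℕ} (σ : ℝ → ℝ) (W : Matrix (Fin m) (Fin d) ℝ)
    (X : Matrix (Fin d) (Fin n) ℝ) : Matrix (Fin m) (Fin n) ℝ :=
  (W * X).map σ

/-- The Euclidean norm of the `t`-th column of `X`. -/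
def colNorm {d n : ℕ} (X : Matrix (Fin d) (Fin n) ℝ) (t : Fin n) : ℝ :=
  ‖WithLp.toLp 2 (X.col t)‖

/-- `a = d^{-1/2} min_t ‖x_t‖₂`. -/
def minScale {d n : ℕ} (X : Matrix (Fin d) (Fin n) ℝ) : ℝ :=
  1 / √(d : ℝ) * ⨅ t : Fin n, colNorm X t

/-- `b = d^{-1/2} max_t ‖x_t‖₂`. -/
def maxScale {d n : ℕ} (X : Matrix (Fin d) (Fin n) ℝ) : ℝ :=
  1 / √(d : ℝ) * ⨆ t : Fin n, colNorm X t

/-- `E[f(γ)]` for a standard Gaussian `γ`. -/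
def gaussianExp (f : ℝ → ℝ) : ℝ := ∫ x, f x ∂(gaussianReal 0 1)

/-- `s_σ(a,b) = sup_{s ∈ [a,b]} E[σ(sγ)²] / (E[σ(sγ)])²`. -/
def gaussianRatio (σ : ℝ → ℝ) (a b : ℝ) : ℝ :=
  ⨆ s : Set.Icc a b,
    gaussianExp (fun x => σ ((s : ℝ) * x) ^ 2) / gaussianExp (fun x => σ ((s : ℝ) * x)) ^ 2

/-- `κ_{σ,q}(a,b) = inf_{s ∈ [a,b]} |E[σ(sγ)]| / s^q`. -/
def gaussianKappa (σ : ℝ → ℝ) (q a b : ℝ) : ℝ :=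
  ⨅ s : Set.Icc a b, |gaussianExp (fun x => σ ((s : ℝ) * x))| / (s : ℝ) ^ q

/-- `r_{p,q} = (L / κ_{σ,q}(a,b)) · sup_{s ∈ [a,b]} s^{p-q}`. -/
def scaleRatio (σ : ℝ → ℝ) (L p q a b : ℝ) : ℝ :=
  L / gaussianKappa σ q a b * ⨆ s : Set.Icc a b, (s : ℝ) ^ (p - q)

/-- `W` is a random matrix on `(Ω, P)` with i.i.d. entries of law `N(0, 1/d)`. -/
structure IsGaussianWeight {Ω : Type*} [MeasurableSpace Ω] {m d : ℕ}
    (W : Ω → Matrix (Fin m) (Fin d) ℝ) (P : Measure Ω) : Prop where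
  indep : iIndepFun (fun (ij : Fin m × Fin d) (ω : Ω) => W ω ij.1 ij.2) P
  law : ∀ i j, HasLaw (fun ω => W ω i j) (gaussianReal 0 (1 / (d : NNReal))) P

/-- The ReLU activation `t ↦ max(t, 0)`. -/
def relu (t : ℝ) : ℝ := max t 0

end

/-!
Test `‖A‖_op` against the all-ones vector on the left and `v_t = E[σ(s_t γ)]` on the right, where
`s_t = d^{-1/2} ‖x_t‖₂`. Since `1ᵀ A v ≤ √m ‖A‖_op ‖v‖`, it suffices that `1ᵀ A v` is not much
smaller than its mean `m ‖v‖²` and that `‖A‖_F²` is not much larger than its mean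
`m ∑ t, E[σ(s_t γ)²] ≤ m s_σ(a, b) ‖v‖²`. Both quantities are sums of `m` independent row
statistics. Each of these is dominated by `r` or `r²` times its mean times a convex combination of
powers `|γ_t| ^ p` or `|γ_t| ^ (2p)` of (dependent) standard Gaussians. Such a combination is
sub-Weibull with parameters that depend only on `p`, and this passes to the row statistics, whose
sums concentrate by truncation and Chernoff's bound.
-/

theorem exp_le_one_add_add_sq_mul_exp_max (u : ℝ) :
    Real.exp u ≤ 1 + u + u ^ 2 * Real.exp (max u 0) := by
  rcases le_total 0 u with hu | hu
  · have hstep : Real.exp u ≤ 1 + u * Real.exp u := by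
      have hneg := mul_le_mul_of_nonneg_right (Real.one_sub_le_exp_neg u) (Real.exp_pos u).le
      rw [← Real.exp_add, neg_add_cancel, Real.exp_zero] at hneg
      linarith
    rw [max_eq_left hu]
    calc Real.exp u ≤ 1 + u * Real.exp u := hstep
      _ ≤ 1 + u * (1 + u * Real.exp u) := by gcongr
      _ = 1 + u + u ^ 2 * Real.exp u := by ring
  · rw [max_eq_right hu, Real.exp_zero, mul_one]
    rcases le_total (-1) u with hu1 | hu1
    · have := (abs_le.mp (Real.abs_exp_sub_one_sub_id_le (abs_le.mpr ⟨hu1, by linarith⟩))).2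
      linarith
    · have := Real.exp_le_one_iff.mpr hu
      nlinarith

theorem sq_le_mul_exp_rpow {α θ x : ℝ} (hα : 0 < α) (hθ : 0 < θ) (hx : 0 ≤ x) :
    x ^ 2 ≤ (4 / (α * θ)) ^ (2 / α) * Real.exp (θ / 2 * x ^ α) := by
  have hlin : x ^ α ≤ 4 / (α * θ) * Real.exp (α * θ / 4 * x ^ α) := by
    calc x ^ α = 4 / (α * θ) * (α * θ / 4 * x ^ α) := by field_simp
      _ ≤ _ := by gcongr; linarith [Real.add_one_le_exp (α * θ / 4 * x ^ α)]
  calc x ^ 2 = (x ^ α) ^ (2 / α) := by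
        rw [← Real.rpow_mul hx, mul_div_cancel₀ _ hα.ne', Real.rpow_two]
    _ ≤ (4 / (α * θ) * Real.exp (α * θ / 4 * x ^ α)) ^ (2 / α) := by gcongr
    _ = _ := by
        rw [Real.mul_rpow (by positivity) (Real.exp_pos _).le, ← Real.exp_mul]
        congr 2
        field_simp
        ring

/-- Raising the bound to the power `log 2 / log C ≤ 1` only weakens it, because `P ≤ 1`. -/
theorem le_two_mul_exp_of_le_mul_exp {C P u : ℝ} (hC : 2 ≤ C) (hP0 : 0 ≤ P) (hP1 : P ≤ 1)
    (hP : P ≤ C * Real.exp (-u)) : P ≤ 2 * Real.exp (-(u * (Real.log 2 / Real.log C))) := by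
  have hlogC : 0 < Real.log C := Real.log_pos (by linarith)
  have hlog : Real.log 2 / Real.log C ≤ 1 :=
    div_le_one_of_le₀ (Real.log_le_log two_pos hC) hlogC.le
  have hlog0 : 0 ≤ Real.log 2 / Real.log C := div_nonneg (Real.log_nonneg one_le_two) hlogC.le
  calc P = P ^ (1 : ℝ) := (Real.rpow_one P).symm
    _ ≤ P ^ (Real.log 2 / Real.log C) := Real.rpow_le_rpow_of_exponent_ge' hP0 hP1 hlog0 hlog
    _ ≤ (C * Real.exp (-u)) ^ (Real.log 2 / Real.log C) := by gcongr
    _ = C ^ (Real.log 2 / Real.log C) * Real.exp (-u) ^ (Real.log 2 / Real.log C) :=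
        Real.mul_rpow (by linarith) (Real.exp_pos _).le
    _ = _ := by
        rw [← Real.exp_mul, Real.rpow_def_of_pos (by linarith), mul_div_cancel₀ _ hlogC.ne',
          Real.exp_log two_pos, neg_mul]

/-- For `x = t * y` this combines `t ^ α ≥ 1 + α * log t` with Bernoulli's inequality. -/
theorem exp_rpow_mul_tangent_le {α θ x y : ℝ} (hθ : 0 ≤ θ) (hx : 0 < x) (hy : 0 < y)
    (hθy : 1 ≤ α * (θ * y ^ α)) :
    Real.exp (θ * y ^ α) * (1 + α * (θ * y ^ α) * (x / y - 1)) ≤ Real.exp (θ * x ^ α) := by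
  have ht : 0 < x / y := div_pos hx hy
  have hlog : 1 + α * Real.log (x / y) ≤ (x / y) ^ α := by
    rw [Real.rpow_def_of_pos ht, mul_comm (Real.log _)]
    linarith [Real.add_one_le_exp (α * Real.log (x / y))]
  have hbernoulli : 1 + α * (θ * y ^ α) * (x / y - 1) ≤ (x / y) ^ (α * (θ * y ^ α)) := by
    simpa using one_add_mul_self_le_rpow_one_add (s := x / y - 1) (by linarith) hθy
  calc Real.exp (θ * y ^ α) * (1 + α * (θ * y ^ α) * (x / y - 1))
      ≤ Real.exp (θ * y ^ α) * (x / y) ^ (α * (θ * y ^ α)) := by gcongr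
    _ = Real.exp (θ * y ^ α * (1 + α * Real.log (x / y))) := by
        rw [Real.rpow_def_of_pos ht, ← Real.exp_add]; ring_nf
    _ ≤ Real.exp (θ * y ^ α * (x / y) ^ α) := by gcongr
    _ = Real.exp (θ * x ^ α) := by
        rw [mul_assoc, ← Real.mul_rpow hy.le ht.le, mul_div_cancel₀ _ hy.ne']

/-- The tangent to `v ↦ exp (θ * v ^ α)` at `y` lies below the graph only when `α * θ * y ^ α ≥ 1`,
so the points are first shifted by the `a` with `α * θ * a ^ α = 1`. -/
theorem exp_rpow_sum_le_mul_sum_exp_rpow {κ : Type*} [Fintype κ] {w v : κ → ℝ}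
    (hw : ∀ k, 0 ≤ w k) (hw1 : ∑ k, w k = 1) (hv : ∀ k, 0 ≤ v k) {α θ : ℝ} (hα : 0 < α)
    (hα1 : α ≤ 1) (hθ : 0 < θ) :
    Real.exp (θ * (∑ k, w k * v k) ^ α) ≤
      Real.exp (1 / α) * ∑ k, w k * Real.exp (θ * v k ^ α) := by
  let a := (1 / (α * θ)) ^ (1 / α)
  have ha : 0 < a := by positivity
  have haα : θ * a ^ α = 1 / α := by
    rw [← Real.rpow_mul (by positivity), one_div_mul_cancel hα.ne', Real.rpow_one]
    field_simp
  let y := ∑ k, w k * (v k + a)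
  have hy : y = ∑ k, w k * v k + a := by
    simp only [y, mul_add, Finset.sum_add_distrib, ← Finset.sum_mul, hw1, one_mul]
  have hmean : 0 ≤ ∑ k, w k * v k := Finset.sum_nonneg fun k _ => mul_nonneg (hw k) (hv k)
  have hay : a ≤ y := by linarith
  have hy0 : 0 < y := ha.trans_le hay
  have hθy : 1 ≤ α * (θ * y ^ α) := by
    calc 1 = α * (θ * a ^ α) := by rw [haα, mul_one_div_cancel hα.ne']
      _ ≤ α * (θ * y ^ α) := by gcongr
  have hcentred : ∑ k, w k * (1 + α * (θ * y ^ α) * ((v k + a) / y - 1)) = 1 := by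
    have hsum : ∑ k, w k * ((v k + a) / y - 1) = 0 := by
      simp only [mul_sub, ← mul_div_assoc, mul_one, Finset.sum_sub_distrib, ← Finset.sum_div, hw1]
      exact sub_eq_zero.mpr (div_self hy0.ne')
    simp only [mul_add, mul_one, mul_left_comm (w _), Finset.sum_add_distrib, ← Finset.mul_sum,
      hw1, hsum, mul_zero, add_zero]
  calc Real.exp (θ * (∑ k, w k * v k) ^ α)
      ≤ Real.exp (θ * y ^ α) := by gcongr; linarith
    _ = ∑ k, w k * (Real.exp (θ * y ^ α) * (1 + α * (θ * y ^ α) * ((v k + a) / y - 1))) := by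
        simp only [mul_left_comm (w _), ← Finset.mul_sum, hcentred, mul_one]
    _ ≤ ∑ k, w k * Real.exp (θ * (v k + a) ^ α) := by
        gcongr with k
        · exact hw k
        · exact exp_rpow_mul_tangent_le hθ.le (by linarith [hv k]) hy0 hθy
    _ ≤ ∑ k, w k * (Real.exp (1 / α) * Real.exp (θ * v k ^ α)) := by
        gcongr with k
        · exact hw k
        · rw [← Real.exp_add, ← haα, ← mul_add, add_comm (a ^ α)]
          gcongr
          exact Real.rpow_add_le_add_rpow (hv k) ha.le hα.le hα1
    _ = _ := by simp only [mul_left_comm (w _), ← Finset.mul_sum]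

/-- `E[exp (θ * |X| ^ α)] ≤ B`: a quantitative form of the statement that `X` is sub-Weibull of
order `α` (subexponential for `α = 1`, sub-Gaussian for `α = 2`). -/
structure HasSubWeibullMoment {Ω : Type*} [MeasurableSpace Ω] (X : Ω → ℝ) (α θ B : ℝ)
    (μ : Measure Ω) : Prop where
  aemeasurable : AEMeasurable X μ
  integrable_exp : Integrable (fun ω => Real.exp (θ * |X ω| ^ α)) μ
  integral_exp_le : ∫ ω, Real.exp (θ * |X ω| ^ α) ∂μ ≤ B

/-- A bound for `E|X|` and for `E[X ^ 2 * exp (θ / 2 * |X| ^ α)]` when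
`HasSubWeibullMoment X α θ B`; it plays the role of the variance proxy of a sub-Gaussian
variable. -/
noncomputable def subWeibullProxy (α θ B : ℝ) : ℝ := (1 + (4 / (α * θ)) ^ (2 / α)) * B

/-- The rate in the tail bound `HasSubWeibullMoment.measureReal_le_sum_le`. The first factor comes
from Chernoff's bound, the second one is the price for the prefactor `2`. -/
noncomputable def subWeibullRate (α θ B : ℝ) : ℝ :=
  min (1 / (4 * subWeibullProxy α θ B)) (θ / 4) *
    (Real.log 2 / Real.log (1 + subWeibullProxy α θ B))

namespace HasSubWeibullMoment

variable {Ω : Type*} [MeasurableSpace Ω] {μ : Measure Ω} {X Y : Ω → ℝ} {α θ B : ℝ}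

theorem of_exp_le {g : Ω → ℝ} (hX : AEMeasurable X μ) (hg : Integrable g μ)
    (hXg : ∀ ω, Real.exp (θ * |X ω| ^ α) ≤ g ω) (hgB : ∫ ω, g ω ∂μ ≤ B) :
    HasSubWeibullMoment X α θ B μ := by
  have hmeas : AEMeasurable (fun ω => Real.exp (θ * |X ω| ^ α)) μ :=
    ((hX.abs.pow_const α).const_mul θ).exp
  have hint : Integrable (fun ω => Real.exp (θ * |X ω| ^ α)) μ := by
    refine hg.mono' hmeas.aestronglyMeasurable (.of_forall fun ω => ?_)
    rw [Real.norm_of_nonneg (Real.exp_pos _).le]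
    exact hXg ω
  exact ⟨hX, hint, (integral_mono hint hg hXg).trans hgB⟩

theorem mono (hX : HasSubWeibullMoment X α θ B μ) (hα : 0 ≤ α) (hθ : 0 ≤ θ)
    (hY : AEMeasurable Y μ) (hYX : ∀ ω, |Y ω| ≤ |X ω|) : HasSubWeibullMoment Y α θ B μ :=
  of_exp_le hY hX.integrable_exp
    (fun ω => Real.exp_le_exp.mpr (by gcongr ?_ * ?_ ^ _; exact hYX ω)) hX.integral_exp_le

theorem comp_hasLaw {S : Type*} [MeasurableSpace S] {ν : Measure S} {f : S → ℝ} {Z : Ω → S}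
    (hf : HasSubWeibullMoment f α θ B ν) (hZ : HasLaw Z ν μ) :
    HasSubWeibullMoment (fun ω => f (Z ω)) α θ B μ := by
  obtain ⟨hZm, rfl⟩ := hZ
  exact ⟨hf.aemeasurable.comp_aemeasurable hZm, hf.integrable_exp.comp_aemeasurable hZm,
    (integral_map hZm hf.integrable_exp.aestronglyMeasurable).symm.trans_le hf.integral_exp_le⟩

theorem one_le [IsProbabilityMeasure μ] (hX : HasSubWeibullMoment X α θ B μ) (hθ : 0 ≤ θ) :
    1 ≤ B := by
  calc (1 : ℝ) = ∫ _, 1 ∂μ := by simp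
    _ ≤ ∫ ω, Real.exp (θ * |X ω| ^ α) ∂μ :=
        integral_mono (integrable_const 1) hX.integrable_exp fun ω =>
          Real.one_le_exp (by positivity)
    _ ≤ B := hX.integral_exp_le

theorem abs_le_mul_exp (hα : 0 < α) (hθ : 0 < θ) (x : ℝ) :
    |x| ≤ (1 + (4 / (α * θ)) ^ (2 / α)) * Real.exp (θ * |x| ^ α) := by
  have hsq := sq_le_mul_exp_rpow hα hθ (abs_nonneg x)
  have hone : 1 ≤ Real.exp (θ * |x| ^ α) := Real.one_le_exp (by positivity)
  have hhalf : Real.exp (θ / 2 * |x| ^ α) ≤ Real.exp (θ * |x| ^ α) := by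
    gcongr
    linarith
  calc |x| ≤ 1 + |x| ^ 2 := by nlinarith [sq_nonneg (|x| - 1)]
    _ ≤ Real.exp (θ * |x| ^ α) + (4 / (α * θ)) ^ (2 / α) * Real.exp (θ * |x| ^ α) := by
        gcongr
        exact hsq.trans (by gcongr)
    _ = _ := by ring

theorem integrable (hX : HasSubWeibullMoment X α θ B μ) (hα : 0 < α) (hθ : 0 < θ) :
    Integrable X μ :=
  (hX.integrable_exp.const_mul _).mono' hX.aemeasurable.aestronglyMeasurable
    (.of_forall fun ω => abs_le_mul_exp hα hθ (X ω))

theorem integral_abs_le (hX : HasSubWeibullMoment X α θ B μ) (hα : 0 < α) (hθ : 0 < θ) :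
    ∫ ω, |X ω| ∂μ ≤ subWeibullProxy α θ B := by
  calc ∫ ω, |X ω| ∂μ
      ≤ ∫ ω, (1 + (4 / (α * θ)) ^ (2 / α)) * Real.exp (θ * |X ω| ^ α) ∂μ :=
        integral_mono (hX.integrable hα hθ).abs (hX.integrable_exp.const_mul _)
          fun ω => abs_le_mul_exp hα hθ (X ω)
    _ = (1 + (4 / (α * θ)) ^ (2 / α)) * ∫ ω, Real.exp (θ * |X ω| ^ α) ∂μ :=
        integral_const_mul _ _
    _ ≤ subWeibullProxy α θ B := by
        rw [subWeibullProxy]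
        gcongr
        exact hX.integral_exp_le

theorem sub_integral (hX : HasSubWeibullMoment X α θ B μ) (hα : 0 < α) (hα1 : α ≤ 1)
    (hθ : 0 < θ) :
    HasSubWeibullMoment (fun ω => X ω - ∫ ω', X ω' ∂μ) α θ
      (Real.exp (θ * subWeibullProxy α θ B ^ α) * B) μ := by
  let A := Real.exp (θ * subWeibullProxy α θ B ^ α)
  have hmean : |∫ ω, X ω ∂μ| ≤ subWeibullProxy α θ B :=
    abs_integral_le_integral_abs.trans (hX.integral_abs_le hα hθ)
  have hexp (ω : Ω) :
      Real.exp (θ * |X ω - ∫ ω', X ω' ∂μ| ^ α) ≤ A * Real.exp (θ * |X ω| ^ α) := by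
    rw [← Real.exp_add, ← mul_add]
    gcongr
    calc |X ω - ∫ ω', X ω' ∂μ| ^ α ≤ (|∫ ω', X ω' ∂μ| + |X ω|) ^ α := by
          gcongr
          rw [add_comm]
          exact abs_sub _ _
      _ ≤ |∫ ω', X ω' ∂μ| ^ α + |X ω| ^ α :=
          Real.rpow_add_le_add_rpow (abs_nonneg _) (abs_nonneg _) hα.le hα1
      _ ≤ _ := by gcongr
  refine of_exp_le (hX.aemeasurable.sub_const _) (hX.integrable_exp.const_mul A) hexp ?_
  rw [integral_const_mul]
  gcongr
  exact hX.integral_exp_le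

theorem sum_mul {κ : Type*} [Fintype κ] {Z : κ → Ω → ℝ} {w : κ → ℝ}
    (hZ : ∀ k, HasSubWeibullMoment (Z k) α θ B μ) (hw : ∀ k, 0 ≤ w k) (hw1 : ∑ k, w k = 1)
    (hα : 0 < α) (hα1 : α ≤ 1) (hθ : 0 < θ) :
    HasSubWeibullMoment (fun ω => ∑ k, w k * Z k ω) α θ (Real.exp (1 / α) * B) μ := by
  let S (ω : Ω) := ∑ k, w k * Real.exp (θ * |Z k ω| ^ α)
  have hexp (ω : Ω) :
      Real.exp (θ * |∑ k, w k * Z k ω| ^ α) ≤ Real.exp (1 / α) * S ω := by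
    refine le_trans ?_ (exp_rpow_sum_le_mul_sum_exp_rpow hw hw1 (fun k => abs_nonneg (Z k ω))
      hα hα1 hθ)
    gcongr
    refine (Finset.abs_sum_le_sum_abs _ _).trans_eq (Finset.sum_congr rfl fun k _ => ?_)
    rw [abs_mul, abs_of_nonneg (hw k)]
  have hterm (k : κ) : Integrable (fun ω => w k * Real.exp (θ * |Z k ω| ^ α)) μ :=
    (hZ k).integrable_exp.const_mul _
  have hS : Integrable S μ := integrable_finsetSum _ fun k _ => hterm k
  refine of_exp_le (Finset.aemeasurable_fun_sum _ fun k _ => (hZ k).aemeasurable.const_mul _)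
    (hS.const_mul _) hexp ?_
  rw [integral_const_mul, integral_finsetSum _ fun k _ => hterm k]
  gcongr
  calc ∑ k, ∫ ω, w k * Real.exp (θ * |Z k ω| ^ α) ∂μ ≤ ∑ k, w k * B := by
        gcongr with k
        rw [integral_const_mul]
        exact mul_le_mul_of_nonneg_left (hZ k).integral_exp_le (hw k)
    _ = B := by rw [← Finset.sum_mul, hw1, one_mul]

end HasSubWeibullMoment

/-- The minimum in the exponent of Chernoff's bound is close to its value at the optimal `l`,
which is `t / (2 * K * m)` unless the truncation at level `t` forces a smaller `l`. -/
theorem chernoff_exponent_le {α θ t K m l : ℝ} (hK : 0 < K) (hm : 0 < m) (hθ : 0 ≤ θ)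
    (ht : 0 < t) (hl : l = min (t / (2 * K * m)) (θ / 2 * t ^ (α - 1))) :
    -l * t + m * (l ^ 2 * K) ≤ -(min (1 / (4 * K)) (θ / 4) * min (t ^ 2 / m) (t ^ α)) := by
  have hl0 : 0 ≤ l := by rw [hl]; positivity
  have hquad : m * (l ^ 2 * K) ≤ l * t / 2 := by
    have hlt : l * (2 * K * m) ≤ t :=
      (le_div_iff₀ (by positivity)).mp (hl.trans_le (min_le_left _ _))
    nlinarith [mul_le_mul_of_nonneg_left hlt hl0]
  have hlin : min (1 / (4 * K)) (θ / 4) * min (t ^ 2 / m) (t ^ α) ≤ l * t / 2 := by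
    rcases min_choice (t / (2 * K * m)) (θ / 2 * t ^ (α - 1)) with h | h
    · calc _ ≤ 1 / (4 * K) * (t ^ 2 / m) := by
            gcongr
            · exact min_le_left _ _
            · exact min_le_left _ _
        _ = l * t / 2 := by rw [hl, h]; field_simp; norm_num
    · calc _ ≤ θ / 4 * t ^ α := by
            gcongr
            · exact min_le_right _ _
            · exact min_le_right _ _
        _ = θ / 4 * (t ^ (α - 1) * t) := by rw [← Real.rpow_add_one ht.ne', sub_add_cancel]
        _ = l * t / 2 := by rw [hl, h]; ring
  linarith

section Concentration

variable {Ω : Type*} [MeasurableSpace Ω] {μ : Measure Ω} {α θ B t : ℝ}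

theorem exp_mul_min_le {l z : ℝ} (hα : 0 < α) (hα1 : α ≤ 1) (hθ : 0 < θ) (ht : 0 < t)
    (hl : 0 ≤ l) (hlt : l ≤ θ / 2 * t ^ (α - 1)) :
    Real.exp (l * min z t) ≤
      1 + l * z + l ^ 2 * ((4 / (α * θ)) ^ (2 / α) * Real.exp (θ * |z| ^ α)) := by
  let y := min z t
  have hyz : y ≤ z := min_le_left _ _
  have hsq : y ^ 2 ≤ |z| ^ 2 := by
    rw [sq_abs]
    rcases min_cases z t with ⟨hy, _⟩ | ⟨hy, htz⟩ <;> simp only [y, hy]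
    · exact le_rfl
    · gcongr
  have hexp : max (l * y) 0 ≤ θ / 2 * |z| ^ α := by
    refine max_le ?_ (by positivity)
    rcases le_or_gt y 0 with hy | hy
    · exact (mul_nonpos_of_nonneg_of_nonpos hl hy).trans (by positivity)
    · have hty : t ^ (α - 1) ≤ y ^ (α - 1) :=
        Real.rpow_le_rpow_of_nonpos hy (min_le_right _ _) (by linarith)
      calc l * y ≤ θ / 2 * t ^ (α - 1) * y := by gcongr
        _ ≤ θ / 2 * y ^ (α - 1) * y := by gcongr
        _ = θ / 2 * y ^ α := by rw [mul_assoc, ← Real.rpow_add_one hy.ne', sub_add_cancel]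
        _ ≤ θ / 2 * |z| ^ α := by
          gcongr
          exact hyz.trans (le_abs_self z)
  have hquad : y ^ 2 * Real.exp (max (l * y) 0) ≤
      (4 / (α * θ)) ^ (2 / α) * Real.exp (θ * |z| ^ α) := by
    calc y ^ 2 * Real.exp (max (l * y) 0) ≤
        ((4 / (α * θ)) ^ (2 / α) * Real.exp (θ / 2 * |z| ^ α)) * Real.exp (θ / 2 * |z| ^ α) := by
          gcongr
          exact hsq.trans (sq_le_mul_exp_rpow hα hθ (abs_nonneg z))
      _ = _ := by rw [mul_assoc, ← Real.exp_add]; ring_nf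
  calc Real.exp (l * y) ≤ 1 + l * y + (l * y) ^ 2 * Real.exp (max (l * y) 0) :=
        exp_le_one_add_add_sq_mul_exp_max _
    _ = 1 + l * y + l ^ 2 * (y ^ 2 * Real.exp (max (l * y) 0)) := by ring
    _ ≤ _ := by gcongr

namespace HasSubWeibullMoment

variable [IsProbabilityMeasure μ] {X : Ω → ℝ}

theorem one_le_subWeibullProxy (hX : HasSubWeibullMoment X α θ B μ) (hα : 0 ≤ α) (hθ : 0 ≤ θ) :
    1 ≤ subWeibullProxy α θ B :=
  one_le_mul_of_one_le_of_one_le (le_add_of_nonneg_right (by positivity)) (hX.one_le hθ)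

theorem subWeibullRate_pos (hX : HasSubWeibullMoment X α θ B μ) (hα : 0 ≤ α) (hθ : 0 < θ) :
    0 < subWeibullRate α θ B := by
  have hK : 1 ≤ subWeibullProxy α θ B := hX.one_le_subWeibullProxy hα hθ.le
  have hlog : 0 < Real.log (1 + subWeibullProxy α θ B) := Real.log_pos (by linarith)
  rw [subWeibullRate]
  positivity

theorem mgf_min_le {l : ℝ} (hX : HasSubWeibullMoment X α θ B μ) (hmean : ∫ ω, X ω ∂μ ≤ 0)
    (hα : 0 < α) (hα1 : α ≤ 1) (hθ : 0 < θ) (ht : 0 < t) (hl : 0 ≤ l)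
    (hlt : l ≤ θ / 2 * t ^ (α - 1)) :
    mgf (fun ω => min (X ω) t) μ l ≤ Real.exp (l ^ 2 * subWeibullProxy α θ B) := by
  let D := (4 / (α * θ)) ^ (2 / α)
  have hlin : Integrable (fun ω => 1 + l * X ω) μ :=
    (integrable_const _).add ((hX.integrable hα hθ).const_mul l)
  have hquad : Integrable (fun ω => l ^ 2 * (D * Real.exp (θ * |X ω| ^ α))) μ :=
    (hX.integrable_exp.const_mul D).const_mul _
  calc mgf (fun ω => min (X ω) t) μ l
      ≤ ∫ ω, (1 + l * X ω + l ^ 2 * (D * Real.exp (θ * |X ω| ^ α))) ∂μ :=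
        integral_mono_of_nonneg (.of_forall fun ω => (Real.exp_pos _).le) (hlin.add hquad)
          (.of_forall fun ω => exp_mul_min_le hα hα1 hθ ht hl hlt)
    _ = 1 + l * ∫ ω, X ω ∂μ + l ^ 2 * (D * ∫ ω, Real.exp (θ * |X ω| ^ α) ∂μ) := by
        rw [integral_add hlin hquad,
          integral_add (integrable_const _) ((hX.integrable hα hθ).const_mul l)]
        simp only [integral_const_mul, integral_const, probReal_univ, one_smul]
    _ ≤ 1 + l * 0 + l ^ 2 * ((1 + D) * B) := by
        gcongr
        · exact le_add_of_nonneg_left zero_le_one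
        · exact hX.integral_exp_le
    _ ≤ _ := by
        rw [mul_zero, add_zero, add_comm]
        exact Real.add_one_le_exp _

theorem measureReal_lt_le (hX : HasSubWeibullMoment X α θ B μ) (hα : 0 ≤ α) (hθ : 0 ≤ θ)
    (ht : 0 ≤ t) : μ.real {ω | t < X ω} ≤ B * Real.exp (-(θ * t ^ α)) := by
  have hmarkov := mul_meas_ge_le_integral_of_nonneg (μ := μ)
    (.of_forall fun ω => (Real.exp_pos (θ * |X ω| ^ α)).le) hX.integrable_exp
    (Real.exp (θ * t ^ α))
  have hsub : {ω | t < X ω} ⊆ {ω | Real.exp (θ * t ^ α) ≤ Real.exp (θ * |X ω| ^ α)} := by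
    intro ω (hω : t < X ω)
    refine Real.exp_le_exp.mpr ?_
    gcongr
    exact hω.le.trans (le_abs_self _)
  rw [Real.exp_neg, ← div_eq_mul_inv, le_div_iff₀' (Real.exp_pos _)]
  calc Real.exp (θ * t ^ α) * μ.real {ω | t < X ω}
      ≤ Real.exp (θ * t ^ α) *
          μ.real {ω | Real.exp (θ * t ^ α) ≤ Real.exp (θ * |X ω| ^ α)} := by
        gcongr
        exact measure_ne_top _ _
    _ ≤ B := hmarkov.trans hX.integral_exp_le

end HasSubWeibullMoment

variable {ι : Type*} [Fintype ι] {X : ι → Ω → ℝ}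

namespace HasSubWeibullMoment

theorem measureReal_le_sum_min_le (hX : ∀ i, HasSubWeibullMoment (X i) α θ B μ)
    (hind : iIndepFun X μ) (hmean : ∀ i, ∫ ω, X i ω ∂μ ≤ 0) [Nonempty ι] (hα : 0 < α)
    (hα1 : α ≤ 1) (hθ : 0 < θ) (ht : 0 < t) :
    μ.real {ω | t ≤ ∑ i, min (X i ω) t} ≤
      Real.exp (-(min (1 / (4 * subWeibullProxy α θ B)) (θ / 4) *
        min (t ^ 2 / Fintype.card ι) (t ^ α))) := by
  have := hind.isProbabilityMeasure
  let K := subWeibullProxy α θ B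
  have hK : 0 < K :=
    zero_lt_one.trans_le ((hX (Classical.arbitrary ι)).one_le_subWeibullProxy hα.le hθ.le)
  let m : ℝ := Fintype.card ι
  have hm : 0 < m := Nat.cast_pos.mpr Fintype.card_pos
  let l := min (t / (2 * K * m)) (θ / 2 * t ^ (α - 1))
  have hl : 0 ≤ l := by positivity
  have hTm (i : ι) : AEMeasurable (fun ω => min (X i ω) t) μ :=
    (hX i).aemeasurable.min aemeasurable_const
  have hTind : iIndepFun (fun i ω => min (X i ω) t) μ :=
    hind.comp (fun _ x => min x t) fun _ => measurable_id.min measurable_const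
  have hchernoff := measure_ge_le_exp_mul_mgf (μ := μ) (X := ∑ i, fun ω => min (X i ω) t) t hl
    (integrable_exp_mul_of_le l (∑ _ : ι, t) hl (Finset.aemeasurable_sum _ fun i _ => hTm i)
      (.of_forall fun ω => by
        rw [Finset.sum_apply]
        exact Finset.sum_le_sum fun i _ => min_le_right _ _))
  rw [hTind.mgf_sum₀ hTm] at hchernoff
  simp only [Finset.sum_apply] at hchernoff
  calc μ.real {ω | t ≤ ∑ i, min (X i ω) t}
      ≤ Real.exp (-l * t) * ∏ i, mgf (fun ω => min (X i ω) t) μ l := hchernoff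
    _ ≤ Real.exp (-l * t) * ∏ _ : ι, Real.exp (l ^ 2 * K) := by
        gcongr with i
        · exact fun i _ => mgf_nonneg
        · exact (hX i).mgf_min_le (hmean i) hα hα1 hθ ht hl (min_le_right _ _)
    _ = Real.exp (-l * t + m * (l ^ 2 * K)) := by
        rw [Finset.prod_const, Finset.card_univ, ← Real.exp_nat_mul, ← Real.exp_add]
    _ ≤ _ := Real.exp_le_exp.mpr (chernoff_exponent_le hK hm hθ.le ht rfl)

theorem measureReal_iUnion_lt_le (hX : ∀ i, HasSubWeibullMoment (X i) α θ B μ)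
    [IsProbabilityMeasure μ] [Nonempty ι] (hα : 0 < α) (hθ : 0 < θ) (ht : 0 < t)
    (hcard : Fintype.card ι ≤ t ^ 2) :
    μ.real (⋃ i, {ω | t < X i ω}) ≤ subWeibullProxy α θ B * Real.exp (-(θ / 2 * t ^ α)) := by
  have hB : 0 ≤ B := zero_le_one.trans ((hX (Classical.arbitrary ι)).one_le hθ.le)
  calc μ.real (⋃ i, {ω | t < X i ω}) ≤ ∑ i, μ.real {ω | t < X i ω} :=
        measureReal_iUnion_fintype_le _
    _ ≤ ∑ _ : ι, B * Real.exp (-(θ * t ^ α)) :=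
        Finset.sum_le_sum fun i _ => (hX i).measureReal_lt_le hα.le hθ.le ht.le
    _ = Fintype.card ι * (B * Real.exp (-(θ * t ^ α))) := by
        rw [Finset.sum_const, Finset.card_univ, nsmul_eq_mul]
    _ ≤ (4 / (α * θ)) ^ (2 / α) * Real.exp (θ / 2 * t ^ α) * (B * Real.exp (-(θ * t ^ α))) := by
        gcongr
        exact hcard.trans (sq_le_mul_exp_rpow hα hθ ht.le)
    _ = (4 / (α * θ)) ^ (2 / α) * B * Real.exp (-(θ / 2 * t ^ α)) := by
        rw [show -(θ / 2 * t ^ α) = θ / 2 * t ^ α + -(θ * t ^ α) by ring, Real.exp_add]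
        ring
    _ ≤ _ := by
        rw [subWeibullProxy]
        gcongr
        exact le_add_of_nonneg_left zero_le_one

theorem measureReal_le_sum_le_mul_exp (hX : ∀ i, HasSubWeibullMoment (X i) α θ B μ)
    (hind : iIndepFun X μ) (hmean : ∀ i, ∫ ω, X i ω ∂μ ≤ 0) [Nonempty ι] (hα : 0 < α)
    (hα1 : α ≤ 1) (hθ : 0 < θ) (ht : 0 < t) (hcard : Fintype.card ι ≤ t ^ 2) :
    μ.real {ω | t ≤ ∑ i, X i ω} ≤ (1 + subWeibullProxy α θ B) *
      Real.exp (-(min (1 / (4 * subWeibullProxy α θ B)) (θ / 4) *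
        min (t ^ 2 / Fintype.card ι) (t ^ α))) := by
  have := hind.isProbabilityMeasure
  have hK : 0 ≤ subWeibullProxy α θ B :=
    zero_le_one.trans ((hX (Classical.arbitrary ι)).one_le_subWeibullProxy hα.le hθ.le)
  have htrunc : {ω | t ≤ ∑ i, X i ω} ⊆
      {ω | t ≤ ∑ i, min (X i ω) t} ∪ ⋃ i, {ω | t < X i ω} := by
    intro ω (hω : t ≤ ∑ i, X i ω)
    by_cases hbig : ∃ i, t < X i ω
    · exact Or.inr (Set.mem_iUnion.mpr hbig)
    · push Not at hbig
      exact Or.inl (hω.trans_eq (Finset.sum_congr rfl fun i _ => (min_eq_left (hbig i)).symm))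
  calc μ.real {ω | t ≤ ∑ i, X i ω}
      ≤ μ.real {ω | t ≤ ∑ i, min (X i ω) t} + μ.real (⋃ i, {ω | t < X i ω}) :=
        (measureReal_mono htrunc).trans (measureReal_union_le _ _)
    _ ≤ _ := add_le_add (measureReal_le_sum_min_le hX hind hmean hα hα1 hθ ht)
        (measureReal_iUnion_lt_le hX hα hθ ht hcard)
    _ ≤ Real.exp (-(min (1 / (4 * subWeibullProxy α θ B)) (θ / 4) *
          min (t ^ 2 / Fintype.card ι) (t ^ α))) + subWeibullProxy α θ B *
        Real.exp (-(min (1 / (4 * subWeibullProxy α θ B)) (θ / 4) *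
          min (t ^ 2 / Fintype.card ι) (t ^ α))) := by
        gcongr
        · exact (min_le_right _ _).trans (by linarith)
        · exact min_le_right _ _
    _ = _ := by ring

theorem measureReal_le_sum_le (hX : ∀ i, HasSubWeibullMoment (X i) α θ B μ)
    (hind : iIndepFun X μ) (hmean : ∀ i, ∫ ω, X i ω ∂μ ≤ 0) (hα : 0 < α)
    (hα1 : α ≤ 1) (hθ : 0 < θ) (ht : 0 < t) :
    μ.real {ω | t ≤ ∑ i, X i ω} ≤
      2 * Real.exp (-(subWeibullRate α θ B * min (t ^ 2 / Fintype.card ι) (t ^ α))) := by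
  have := hind.isProbabilityMeasure
  rcases isEmpty_or_nonempty ι with _ | ⟨⟨i⟩⟩
  · simpa [ht.not_ge] using (Real.exp_pos _).le
  have : Nonempty ι := ⟨i⟩
  have hK : 1 ≤ subWeibullProxy α θ B := (hX i).one_le_subWeibullProxy hα.le hθ.le
  rw [subWeibullRate, mul_right_comm]
  refine le_two_mul_exp_of_le_mul_exp (by linarith) measureReal_nonneg measureReal_le_one ?_
  rcases le_total (Fintype.card ι : ℝ) (t ^ 2) with hcard | hcard
  · exact measureReal_le_sum_le_mul_exp hX hind hmean hα hα1 hθ ht hcard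
  · have hexponent : min (1 / (4 * subWeibullProxy α θ B)) (θ / 4) *
        min (t ^ 2 / Fintype.card ι) (t ^ α) ≤ 1 / 4 * 1 := by
      gcongr
      · refine (min_le_left _ _).trans ?_
        gcongr
        linarith
      · exact (min_le_left _ _).trans (div_le_one_of_le₀ hcard (by positivity))
    calc μ.real {ω | t ≤ ∑ i, X i ω} ≤ 1 := measureReal_le_one
      _ ≤ (1 + 1) * Real.exp (-(1 / 4 * 1)) := by linarith [Real.one_sub_le_exp_neg (1 / 4 * 1)]
      _ ≤ _ := by gcongr

end HasSubWeibullMoment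

end Concentration

/-- The exponent, up to a constant, of the probability that the mean of `m` independent copies of
the `1 / β`-th power of a subexponential variable is off by `x`: Gaussian for small `x`, and
dominated by a single summand when `β < 1` and `x` is large. -/
noncomputable def mixedTailExponent (m β x : ℝ) : ℝ :=
  min (m * x ^ 2) (m ^ min 1 β * x ^ β)

theorem mixedTailExponent_div_le {m β x K : ℝ} (hm : 0 < m) (hx : 0 < x) (hK : 1 ≤ K)
    (hxK : 1 < β → x ≤ K) :
    mixedTailExponent m β x / K ≤ min ((m * x) ^ 2 / m) ((m * x) ^ min 1 β) := by
  have hK0 : 0 < K := zero_lt_one.trans_le hK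
  rw [mixedTailExponent, div_le_iff₀ hK0]
  have hsq : (m * x) ^ 2 / m = m * x ^ 2 := by field_simp
  have hmono {y z : ℝ} (hy : 0 ≤ y) (hyz : y ≤ z) : y ≤ z * K :=
    hyz.trans (le_mul_of_one_le_right (hy.trans hyz) hK)
  rw [hsq, min_mul_of_nonneg _ _ hK0.le]
  refine le_min ((min_le_left _ _).trans (hmono (by positivity) le_rfl)) ?_
  rcases le_or_gt β 1 with hβ | hβ
  · rw [min_eq_right hβ, Real.mul_rpow hm.le hx.le]
    exact (min_le_right _ _).trans (hmono (by positivity) le_rfl)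
  · rw [min_eq_left hβ.le]
    calc min (m * x ^ 2) (m ^ (1 : ℝ) * x ^ β) ≤ m * x * x := by
          rw [mul_assoc, ← sq]
          exact min_le_left _ _
      _ ≤ m * x * K := by
          gcongr
          exact hxK hβ
      _ = (m * x) ^ (1 : ℝ) * K := by rw [Real.rpow_one]

/-- The rate in `HasSubWeibullMoment.measureReal_le_sum_sub_integral_le`: centring a variable
replaces `B` by `exp (θ * K ^ α) * B`, where `K` bounds its mean. -/
noncomputable def centredSubWeibullRate (α θ B : ℝ) : ℝ :=
  subWeibullRate α θ (Real.exp (θ * subWeibullProxy α θ B ^ α) * B) / subWeibullProxy α θ B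

namespace HasSubWeibullMoment

variable {Ω ι : Type*} [MeasurableSpace Ω] [Fintype ι] {μ : Measure Ω} {β θ B : ℝ}

theorem centredSubWeibullRate_pos [IsProbabilityMeasure μ] {X : Ω → ℝ} {α : ℝ}
    (hX : HasSubWeibullMoment X α θ B μ) (hα : 0 < α) (hα1 : α ≤ 1) (hθ : 0 < θ) :
    0 < centredSubWeibullRate α θ B :=
  div_pos ((hX.sub_integral hα hα1 hθ).subWeibullRate_pos hα.le hθ)
    (zero_lt_one.trans_le (hX.one_le_subWeibullProxy hα.le hθ.le))

theorem measureReal_le_sum_sub_integral_le {X : ι → Ω → ℝ} {x : ℝ}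
    (hX : ∀ i, HasSubWeibullMoment (X i) (min 1 β) θ B μ) (hind : iIndepFun X μ) (hβ : 0 < β)
    (hθ : 0 < θ) (hx : 0 < x) (hxβ : 1 < β → x ≤ subWeibullProxy (min 1 β) θ B) :
    μ.real {ω | Fintype.card ι * x ≤ ∑ i, (X i ω - ∫ ω', X i ω' ∂μ)} ≤
      2 * Real.exp (-(centredSubWeibullRate (min 1 β) θ B *
        mixedTailExponent (Fintype.card ι) β x)) := by
  have := hind.isProbabilityMeasure
  have hα : 0 < min 1 β := lt_min zero_lt_one hβ
  have hα1 : min 1 β ≤ 1 := min_le_left _ _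
  rcases isEmpty_or_nonempty ι with _ | ⟨⟨i⟩⟩
  · simp [mixedTailExponent, Real.zero_rpow hα.ne']
  have hm : (0 : ℝ) < Fintype.card ι := Nat.cast_pos.mpr (Fintype.card_pos_iff.mpr ⟨i⟩)
  have hcentred (j : ι) := (hX j).sub_integral hα hα1 hθ
  have hmean (j : ι) : ∫ ω, (X j ω - ∫ ω', X j ω' ∂μ) ∂μ ≤ 0 := by
    rw [integral_sub ((hX j).integrable hα hθ) (integrable_const _)]
    simp
  have hind' : iIndepFun (fun j ω => X j ω - ∫ ω', X j ω' ∂μ) μ :=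
    hind.comp (fun j y => y - ∫ ω', X j ω' ∂μ) fun _ => measurable_id.sub_const _
  refine (measureReal_le_sum_le hcentred hind' hmean hα hα1 hθ (mul_pos hm hx)).trans ?_
  rw [centredSubWeibullRate, div_mul_eq_mul_div, mul_div_assoc]
  gcongr
  · exact ((hcentred i).subWeibullRate_pos hα.le hθ).le
  · exact mixedTailExponent_div_le hm hx ((hX i).one_le_subWeibullProxy hα.le hθ.le) hxβ

theorem measureReal_le_sum_sub_le_of_abs_le {V Y : ι → Ω → ℝ} {R y ε : ℝ}
    (hV : ∀ i, HasSubWeibullMoment (V i) (min 1 β) θ B μ) (hYm : ∀ i, AEMeasurable (Y i) μ)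
    (hYV : ∀ i ω, |Y i ω| ≤ R * |V i ω|) (hind : iIndepFun Y μ)
    (hmean : ∀ i, ∫ ω, Y i ω ∂μ = y) (hβ : 0 < β) (hθ : 0 < θ) (hR : 0 < R) (hε : 0 < ε)
    (hεβ : 1 < β → ε ≤ |y|) :
    μ.real {ω | Fintype.card ι * ε ≤ ∑ i, (Y i ω - y)} ≤
      2 * Real.exp (-(centredSubWeibullRate (min 1 β) θ B *
        mixedTailExponent (Fintype.card ι) β (ε / R))) := by
  have := hind.isProbabilityMeasure
  have hα : 0 < min 1 β := lt_min zero_lt_one hβ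
  rcases isEmpty_or_nonempty ι with _ | ⟨⟨i⟩⟩
  · simp [mixedTailExponent, Real.zero_rpow hα.ne']
  have hX (j : ι) : HasSubWeibullMoment (fun ω => Y j ω / R) (min 1 β) θ B μ := by
    refine (hV j).mono hα.le hθ.le ((hYm j).div_const R) fun ω => ?_
    rw [abs_div, abs_of_pos hR, div_le_iff₀' hR]
    exact hYV j ω
  have hXmean (j : ι) : ∫ ω, Y j ω / R ∂μ = y / R := by rw [integral_div, hmean]
  have hyK : |y| / R ≤ subWeibullProxy (min 1 β) θ B := by
    calc |y| / R = |∫ ω, Y i ω / R ∂μ| := by rw [hXmean, abs_div, abs_of_pos hR]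
      _ ≤ _ := abs_integral_le_integral_abs.trans ((hX i).integral_abs_le hα hθ)
  have htail := measureReal_le_sum_sub_integral_le hX
    (hind.comp (fun _ z => z / R) fun _ => measurable_id.div_const R) hβ hθ (div_pos hε hR)
    fun h => (div_le_div_of_nonneg_right (hεβ h) hR.le).trans hyK
  have hscale : {ω | Fintype.card ι * ε ≤ ∑ i, (Y i ω - y)} ⊆
      {ω | Fintype.card ι * (ε / R) ≤ ∑ i, (Y i ω / R - ∫ ω', Y i ω' / R ∂μ)} := by
    intro ω (hω : Fintype.card ι * ε ≤ ∑ i, (Y i ω - y))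
    simp only [hXmean, Set.mem_ofPred_eq, ← sub_div, ← Finset.sum_div, ← mul_div_assoc]
    gcongr
  exact (measureReal_mono hscale).trans htail

end HasSubWeibullMoment

theorem exists_hasSubWeibullMoment_abs_rpow_gaussianReal {p : ℝ} (hp : 0 < p) :
    ∃ θ B : ℝ, 0 < θ ∧
      HasSubWeibullMoment (fun x => |x| ^ p) (min 1 (2 / p)) θ B (gaussianReal 0 1) := by
  obtain ⟨θ, hθ, hint⟩ := IsGaussian.exists_integrable_exp_sq (gaussianReal 0 1)
  let α := min 1 (2 / p)
  have hpα : p * α ≤ 2 := by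
    calc p * α ≤ p * (2 / p) := by gcongr; exact min_le_right _ _
      _ = 2 := by field_simp
  have hpow (x : ℝ) : |x| ^ (p * α) ≤ 1 + |x| ^ 2 := by
    rcases le_total |x| 1 with hx | hx
    · exact (Real.rpow_le_one (abs_nonneg x) hx (by positivity)).trans
        (le_add_of_nonneg_right (sq_nonneg _))
    · calc |x| ^ (p * α) ≤ |x| ^ (2 : ℝ) := Real.rpow_le_rpow_of_exponent_le hx hpα
        _ ≤ 1 + |x| ^ 2 := by rw [Real.rpow_two]; exact le_add_of_nonneg_left zero_le_one
  refine ⟨θ, ∫ x, Real.exp θ * Real.exp (θ * ‖x‖ ^ 2) ∂(gaussianReal 0 1), hθ,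
    .of_exp_le (by fun_prop) (hint.const_mul _) (fun x => ?_) le_rfl⟩
  rw [abs_of_nonneg (by positivity), ← Real.rpow_mul (abs_nonneg x), ← Real.exp_add,
    Real.norm_eq_abs, ← mul_one_add]
  gcongr
  exact hpow x

section Matrices

variable {m n : ℕ} {A : Matrix (Fin m) (Fin n) ℝ}

theorem frobNorm_sq (A : Matrix (Fin m) (Fin n) ℝ) : frobNorm A ^ 2 = ∑ i, ∑ t, A i t ^ 2 := by
  rw [frobNorm, Matrix.frobenius_norm_def, ← Real.sqrt_eq_rpow]
  simp only [Real.norm_eq_abs, Real.rpow_two, sq_abs]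
  exact Real.sq_sqrt (by positivity)

theorem opNorm_zero : opNorm (0 : Matrix (Fin m) (Fin n) ℝ) = 0 := by
  let := Matrix.instL2OpNormedAddCommGroup (m := Fin m) (n := Fin n) (𝕜 := ℝ)
  exact norm_zero

theorem sum_mulVec_sq_le (A : Matrix (Fin m) (Fin n) ℝ) (v : Fin n → ℝ) :
    ∑ i, (A.mulVec v i) ^ 2 ≤ opNorm A ^ 2 * ∑ t, v t ^ 2 := by
  have hop := pow_le_pow_left₀ (norm_nonneg _) (Matrix.l2_opNorm_mulVec A (WithLp.toLp 2 v)) 2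
  simpa [mul_pow, EuclideanSpace.norm_sq_eq, opNorm] using hop

theorem sq_sum_mulVec_le (A : Matrix (Fin m) (Fin n) ℝ) (v : Fin n → ℝ) :
    (∑ i, A.mulVec v i) ^ 2 ≤ m * (opNorm A ^ 2 * ∑ t, v t ^ 2) := by
  calc (∑ i, A.mulVec v i) ^ 2 ≤ m * ∑ i, (A.mulVec v i) ^ 2 := by
        simpa using sq_sum_le_card_mul_sum_sq (s := Finset.univ) (f := A.mulVec v)
    _ ≤ _ := by gcongr; exact sum_mulVec_sq_le A v

theorem ne_zero_and_stableRank_le {v : Fin n → ℝ} {l u : ℝ} (hv : 0 < ∑ t, v t ^ 2)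
    (hl : 0 < l) (hlow : m * (l * ∑ t, v t ^ 2) < ∑ i, A.mulVec v i)
    (hup : ∑ i, ∑ t, A i t ^ 2 ≤ m * (u * ∑ t, v t ^ 2)) :
    A ≠ 0 ∧ stableRank A ≤ u / l ^ 2 := by
  have hm : (0 : ℝ) < m := by
    rcases Nat.eq_zero_or_pos m with rfl | hm
    · simp at hlow
    · exact Nat.cast_pos.mpr hm
  set S := ∑ t, v t ^ 2
  have hop : m * (l ^ 2 * S) ≤ opNorm A ^ 2 := by
    refine le_of_mul_le_mul_right ?_ (mul_pos hm hv)
    calc m * (l ^ 2 * S) * (m * S) = (m * (l * S)) ^ 2 := by ring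
      _ ≤ (∑ i, A.mulVec v i) ^ 2 := pow_le_pow_left₀ (by positivity) hlow.le 2
      _ ≤ m * (opNorm A ^ 2 * S) := sq_sum_mulVec_le A v
      _ = opNorm A ^ 2 * (m * S) := by ring
  have hop0 : 0 < m * (l ^ 2 * S) := by positivity
  constructor
  · rintro rfl
    rw [opNorm_zero] at hop
    linarith
  · have hup0 : 0 ≤ m * (u * S) := le_trans (by positivity) hup
    rw [stableRank, frobNorm_sq]
    calc (∑ i, ∑ t, A i t ^ 2) / opNorm A ^ 2 ≤ m * (u * S) / (m * (l ^ 2 * S)) := by gcongr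
      _ = u / l ^ 2 := by field_simp

end Matrices

section GaussianWeights

variable {Ω : Type*} [MeasurableSpace Ω] {P : Measure Ω} {m d n : ℕ}
  {W : Ω → Matrix (Fin m) (Fin d) ℝ} {X : Matrix (Fin d) (Fin n) ℝ}

/-- The standard deviation `s_t = d^{-1/2} ‖x_t‖₂` of the pre-activations in column `t`. -/
noncomputable def preactivationScale (X : Matrix (Fin d) (Fin n) ℝ) (t : Fin n) : ℝ :=
  1 / √(d : ℝ) * colNorm X t

theorem preactivationScale_sq (X : Matrix (Fin d) (Fin n) ℝ) (t : Fin n) :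
    preactivationScale X t ^ 2 = ∑ j, X j t ^ 2 * (1 / d) := by
  rw [preactivationScale, colNorm, mul_pow, EuclideanSpace.norm_sq_eq, div_pow,
    Real.sq_sqrt d.cast_nonneg, one_pow, mul_comm, Finset.sum_mul]
  simp only [Matrix.col_apply, Real.norm_eq_abs, sq_abs]

theorem preactivationScale_pos {t : Fin n} (hX : X.col t ≠ 0) : 0 < preactivationScale X t := by
  have hd : d ≠ 0 := by
    rintro rfl
    exact hX (Subsingleton.elim _ _)
  have hnorm : 0 < colNorm X t := by
    rw [colNorm, norm_pos_iff]
    simpa using hX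
  rw [preactivationScale]
  positivity

theorem preactivationScale_mem_Icc (X : Matrix (Fin d) (Fin n) ℝ) (t : Fin n) :
    preactivationScale X t ∈ Set.Icc (minScale X) (maxScale X) :=
  ⟨mul_le_mul_of_nonneg_left (ciInf_le (Set.finite_range _).bddBelow t) (by positivity),
    mul_le_mul_of_nonneg_left (le_ciSup (Set.finite_range _).bddAbove t) (by positivity)⟩

theorem minScale_le_maxScale [Nonempty (Fin n)] (X : Matrix (Fin d) (Fin n) ℝ) :
    minScale X ≤ maxScale X :=
  let hmem := preactivationScale_mem_Icc X (Classical.arbitrary _)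
  hmem.1.trans hmem.2

theorem minScale_pos [Nonempty (Fin n)] (hX : ∀ t, X.col t ≠ 0) : 0 < minScale X := by
  obtain ⟨t, ht⟩ := exists_eq_ciInf_of_finite (f := fun t => colNorm X t)
  rw [minScale, ← ht]
  exact preactivationScale_pos (hX t)

theorem hasLaw_sum_gaussianReal {ι : Type*} [Fintype ι] {Z : ι → Ω → ℝ} {a : ι → ℝ}
    {v : ι → NNReal} (hind : iIndepFun Z P) (hZ : ∀ j, HasLaw (Z j) (gaussianReal (a j) (v j)) P) :
    HasLaw (fun ω => ∑ j, Z j ω) (gaussianReal (∑ j, a j) (∑ j, v j)) P := by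
  have := hind.isProbabilityMeasure
  have hgauss (j : ι) : HasGaussianLaw (Z j) P := (hZ j).hasGaussianLaw
  have hL2 (j : ι) : MemLp (Z j) 2 P := (hgauss j).memLp_two
  have hmean : ∫ ω, ∑ j, Z j ω ∂P = ∑ j, a j := by
    rw [integral_finsetSum _ fun j _ => (hgauss j).integrable]
    exact Finset.sum_congr rfl fun j _ => by rw [(hZ j).integral_eq, integral_id_gaussianReal]
  have hvar : Var[fun ω => ∑ j, Z j ω; P] = ∑ j, v j := by
    rw [← Finset.sum_fn,
      IndepFun.variance_sum (fun j _ => hL2 j) fun i _ j _ hij => hind.indepFun hij]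
    push_cast
    exact Finset.sum_congr rfl fun j _ => by rw [(hZ j).variance_eq, variance_id_gaussianReal]
  have hsum := hind.hasGaussianLaw_fun_sum hgauss
  refine ⟨hsum.aemeasurable, ?_⟩
  rw [hsum.map_eq_gaussianReal, hmean, hvar, Real.toNNReal_coe]

/-- The rate in the tail bound for sums over the rows of `W X` of a statistic that grows like the
`p`-th power of the entries, in terms of the parameters of `|γ| ^ p` for a standard Gaussian `γ`. -/
noncomputable def rowStatisticRate (p θ B : ℝ) : ℝ :=
  centredSubWeibullRate (min 1 (2 / p)) θ (Real.exp (1 / min 1 (2 / p)) * B)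

theorem rowStatisticRate_pos {p θ B : ℝ}
    (hγ : HasSubWeibullMoment (fun x => |x| ^ p) (min 1 (2 / p)) θ B (gaussianReal 0 1))
    (hp : 0 < p) (hθ : 0 < θ) : 0 < rowStatisticRate p θ B :=
  (HasSubWeibullMoment.sum_mul (κ := Unit) (w := 1) (fun _ => hγ) (fun _ => zero_le_one) (by simp)
    (by positivity) (min_le_left _ _) hθ).centredSubWeibullRate_pos (by positivity)
    (min_le_left _ _) hθ

namespace IsGaussianWeight

theorem aemeasurable_row (hW : IsGaussianWeight W P) (i : Fin m) :
    AEMeasurable (fun ω => W ω i) P :=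
  aemeasurable_pi_lambda _ fun j => (hW.law i j).aemeasurable

theorem iIndepFun_row (hW : IsGaussianWeight W P) : iIndepFun (fun i ω => W ω i) P := by
  have := hW.indep.isProbabilityMeasure
  let γ := gaussianReal 0 (1 / (d : NNReal))
  have hrow (i : Fin m) : HasLaw (fun ω => W ω i) (Measure.pi fun _ => γ) P :=
    iIndepFun.hasLaw_pi (hW.law i)
      (hW.indep.precomp (g := fun j => (i, j)) fun _ _ h => (Prod.ext_iff.mp h).2)
  have hall := iIndepFun.hasLaw_pi (fun ij : Fin m × Fin d => hW.law ij.1 ij.2) hW.indep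
  have hcurry := Measure.infinitePi_map_curry (fun (_ : Fin m) (_ : Fin d) => γ)
  simp only [Measure.infinitePi_eq_pi] at hcurry
  rw [iIndepFun_iff_hasLaw_pi_pi hrow]
  refine ⟨aemeasurable_pi_lambda _ hW.aemeasurable_row, ?_⟩
  rw [← hcurry, ← hall.map_eq, AEMeasurable.map_map_of_aemeasurable
    (MeasurableEquiv.measurable _).aemeasurable hall.aemeasurable]
  rfl

theorem hasLaw_mul_div_preactivationScale (hW : IsGaussianWeight W P) {t : Fin n}
    (hX : X.col t ≠ 0) (i : Fin m) :
    HasLaw (fun ω => (W ω * X) i t / preactivationScale X t) (gaussianReal 0 1) P := by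
  have hs := preactivationScale_pos hX
  have hind : iIndepFun (fun j ω => W ω i j * X j t) P :=
    (hW.indep.precomp (g := fun j => (i, j)) fun _ _ h => (Prod.ext_iff.mp h).2).comp
      (fun j z => z * X j t) fun j => measurable_id.mul_const _
  have hlaw := gaussianReal_div_const
    (hasLaw_sum_gaussianReal hind fun j => gaussianReal_mul_const (hW.law i j) (X j t))
    (preactivationScale X t)
  simp only [Matrix.mul_apply]
  convert hlaw using 2
  · simp
  · refine NNReal.coe_injective ?_
    push_cast
    rw [← preactivationScale_sq, div_self (by positivity)]

section RowStatistic

variable {f : Fin n → ℝ → ℝ}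

theorem aemeasurable_rowStatistic (hW : IsGaussianWeight W P) (X : Matrix (Fin d) (Fin n) ℝ)
    (hf : ∀ t, Measurable (f t)) (i : Fin m) :
    AEMeasurable (fun ω => ∑ t, f t ((W ω * X) i t)) P :=
  (Finset.measurable_fun_sum _ fun t _ => (hf t).comp (by fun_prop) :
    Measurable fun w : Fin d → ℝ => ∑ t, f t (∑ j, w j * X j t)).comp_aemeasurable
    (hW.aemeasurable_row i)

theorem iIndepFun_rowStatistic (hW : IsGaussianWeight W P) (X : Matrix (Fin d) (Fin n) ℝ)
    (hf : ∀ t, Measurable (f t)) :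
    iIndepFun (fun (i : Fin m) ω => ∑ t, f t ((W ω * X) i t)) P :=
  hW.iIndepFun_row.comp (fun _ w => ∑ t, f t (∑ j, w j * X j t)) fun _ =>
    Finset.measurable_fun_sum _ fun t _ => (hf t).comp (by fun_prop)

theorem integral_rowStatistic (hW : IsGaussianWeight W P) (hX : ∀ t, X.col t ≠ 0)
    (hf : ∀ t, Integrable (fun x => f t (preactivationScale X t * x)) (gaussianReal 0 1))
    (i : Fin m) :
    ∫ ω, ∑ t, f t ((W ω * X) i t) ∂P =
      ∑ t, gaussianExp (fun x => f t (preactivationScale X t * x)) := by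
  have hscale (t : Fin n) (ω : Ω) : f t ((W ω * X) i t) =
      f t (preactivationScale X t * ((W ω * X) i t / preactivationScale X t)) := by
    rw [mul_div_cancel₀ _ (preactivationScale_pos (hX t)).ne']
  have hlaw (t : Fin n) := hW.hasLaw_mul_div_preactivationScale (hX t) i
  simp only [hscale]
  rw [integral_finsetSum _ fun t _ => ?_]
  · exact Finset.sum_congr rfl fun t _ => (hlaw t).integral_comp (hf t).aestronglyMeasurable
  · have hft := hf t
    rw [← (hlaw t).map_eq] at hft
    exact hft.comp_aemeasurable (hlaw t).aemeasurable

theorem measureReal_le_sum_rowStatistic_sub_le {p θ B ε : ℝ} {C : Fin n → ℝ}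
    (hW : IsGaussianWeight W P) (hX : ∀ t, X.col t ≠ 0) (hf : ∀ t, Measurable (f t))
    (hγ : HasSubWeibullMoment (fun x => |x| ^ p) (min 1 (2 / p)) θ B (gaussianReal 0 1))
    (hp : 0 < p) (hθ : 0 < θ) (hC : ∀ t, 0 ≤ C t) (hC0 : 0 < ∑ t, C t)
    (hfC : ∀ t x, |f t (preactivationScale X t * x)| ≤ C t * |x| ^ p) (hε : 0 < ε)
    (hεp : p < 2 → ε ≤ |∑ t, gaussianExp (fun x => f t (preactivationScale X t * x))|) :
    P.real {ω | m * ε ≤ ∑ i, (∑ t, f t ((W ω * X) i t) -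
        ∑ t, gaussianExp (fun x => f t (preactivationScale X t * x)))} ≤
      2 * Real.exp (-(rowStatisticRate p θ B *
        mixedTailExponent m (2 / p) (ε / ∑ t, C t))) := by
  have hα : 0 < min 1 (2 / p) := by positivity
  have hint (t : Fin n) :
      Integrable (fun x => f t (preactivationScale X t * x)) (gaussianReal 0 1) :=
    ((hγ.integrable hα hθ).const_mul (C t)).mono'
      ((hf t).comp (measurable_const_mul _)).aestronglyMeasurable (.of_forall (hfC t))
  let V (i : Fin m) (ω : Ω) : ℝ :=
    ∑ t, C t / (∑ t, C t) * |(W ω * X) i t / preactivationScale X t| ^ p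
  have hV (i : Fin m) :
      HasSubWeibullMoment (V i) (min 1 (2 / p)) θ (Real.exp (1 / min 1 (2 / p)) * B) P :=
    HasSubWeibullMoment.sum_mul
      (fun t => hγ.comp_hasLaw (hW.hasLaw_mul_div_preactivationScale (hX t) i))
      (fun t => div_nonneg (hC t) hC0.le) (by rw [← Finset.sum_div, div_self hC0.ne'])
      hα (min_le_left _ _) hθ
  have hdom (i : Fin m) (ω : Ω) :
      |∑ t, f t ((W ω * X) i t)| ≤ (∑ t, C t) * |V i ω| := by
    refine (Finset.abs_sum_le_sum_abs _ _).trans ?_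
    calc ∑ t, |f t ((W ω * X) i t)|
        ≤ ∑ t, C t * |(W ω * X) i t / preactivationScale X t| ^ p := by
          gcongr with t
          simpa only [mul_div_cancel₀ _ (preactivationScale_pos (hX t)).ne'] using
            hfC t ((W ω * X) i t / preactivationScale X t)
      _ = (∑ t, C t) * V i ω := by
          rw [Finset.mul_sum]
          exact Finset.sum_congr rfl fun t _ => by field_simp
      _ ≤ _ := by gcongr; exact le_abs_self _
  simpa only [Fintype.card_fin, rowStatisticRate] using
    HasSubWeibullMoment.measureReal_le_sum_sub_le_of_abs_le hV
      (hW.aemeasurable_rowStatistic X hf) hdom (hW.iIndepFun_rowStatistic X hf)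
      (hW.integral_rowStatistic hX hint) (by positivity) hθ hC0 hε
      fun h => hεp ((one_lt_div hp).mp h)

end RowStatistic

end IsGaussianWeight

end GaussianWeights

theorem one_sub_sub_le_measureReal {Ω : Type*} [MeasurableSpace Ω] {P : Measure Ω}
    [IsProbabilityMeasure P] {bad₁ bad₂ good : Set Ω}
    (h : ∀ ω, ω ∉ bad₁ → ω ∉ bad₂ → ω ∈ good) : 1 - P.real bad₁ - P.real bad₂ ≤ P.real good := by
  have hcover : (Set.univ : Set Ω) ⊆ good ∪ bad₁ ∪ bad₂ := fun ω _ => by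
    by_contra hω
    simp only [Set.mem_union, not_or] at hω
    exact hω.1.1 (h ω hω.1.2 hω.2)
  have hle : 1 ≤ P.real good + P.real bad₁ + P.real bad₂ := by
    calc 1 = P.real Set.univ := probReal_univ.symm
      _ ≤ P.real (good ∪ bad₁ ∪ bad₂) := measureReal_mono hcover
      _ ≤ P.real (good ∪ bad₁) + P.real bad₂ := measureReal_union_le _ _
      _ ≤ _ := by gcongr; exact measureReal_union_le _ _
  linarith

section Activation

variable {σ : ℝ → ℝ} {L p q r a b s v : ℝ}

theorem nonneg_of_abs_le_mul_abs_rpow (hL : ∀ t, |σ t| ≤ L * |t| ^ p) : 0 ≤ L := by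
  simpa using (abs_nonneg _).trans (hL 1)

theorem abs_comp_mul_le (hL : ∀ t, |σ t| ≤ L * |t| ^ p) (hs : 0 ≤ s) (x : ℝ) :
    |σ (s * x)| ≤ L * s ^ p * |x| ^ p := by
  refine (hL _).trans_eq ?_
  rw [abs_mul, abs_of_nonneg hs, Real.mul_rpow hs (abs_nonneg x), mul_assoc]

theorem sq_comp_mul_le (hL : ∀ t, |σ t| ≤ L * |t| ^ p) (hs : 0 ≤ s) (x : ℝ) :
    σ (s * x) ^ 2 ≤ (L * s ^ p) ^ 2 * |x| ^ (2 * p) := by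
  rw [← sq_abs, mul_comm 2 p, Real.rpow_mul (abs_nonneg x), Real.rpow_two, ← mul_pow]
  exact pow_le_pow_left₀ (abs_nonneg _) (abs_comp_mul_le hL hs x) 2

theorem abs_mul_comp_mul_le (hL : ∀ t, |σ t| ≤ L * |t| ^ p) (hs : 0 ≤ s)
    (hv : L * s ^ p ≤ r * |v|) (x : ℝ) : |v * σ (s * x)| ≤ r * v ^ 2 * |x| ^ p := by
  calc |v * σ (s * x)| ≤ |v| * (L * s ^ p * |x| ^ p) := by
        rw [abs_mul]
        gcongr
        exact abs_comp_mul_le hL hs x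
    _ ≤ |v| * (r * |v| * |x| ^ p) := by gcongr
    _ = r * v ^ 2 * |x| ^ p := by rw [← sq_abs v]; ring

theorem sq_comp_mul_le_of_le (hL : ∀ t, |σ t| ≤ L * |t| ^ p) (hs : 0 ≤ s)
    (hv : L * s ^ p ≤ r * |v|) (x : ℝ) : σ (s * x) ^ 2 ≤ r ^ 2 * v ^ 2 * |x| ^ (2 * p) := by
  have hLs : 0 ≤ L * s ^ p :=
    mul_nonneg (nonneg_of_abs_le_mul_abs_rpow hL) (Real.rpow_nonneg hs p)
  refine (sq_comp_mul_le hL hs x).trans ?_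
  rw [← sq_abs v, ← mul_pow]
  gcongr

theorem integrable_abs_rpow_gaussianReal (hp : 0 < p) :
    Integrable (fun x : ℝ => |x| ^ p) (gaussianReal 0 1) := by
  obtain ⟨θ, B, hθ, h⟩ := exists_hasSubWeibullMoment_abs_rpow_gaussianReal hp
  exact h.integrable (by positivity) hθ

theorem memLp_two_comp_mul (hσ : Measurable σ) (hL : ∀ t, |σ t| ≤ L * |t| ^ p) (hp : 0 < p)
    (hs : 0 ≤ s) : MemLp (fun x => σ (s * x)) 2 (gaussianReal 0 1) := by
  have hm : Measurable fun x => σ (s * x) := hσ.comp (measurable_const_mul s)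
  refine (memLp_two_iff_integrable_sq hm.aestronglyMeasurable).mpr
    (((integrable_abs_rpow_gaussianReal (p := 2 * p) (by positivity)).const_mul
      ((L * s ^ p) ^ 2)).mono' (hm.pow_const 2).aestronglyMeasurable (.of_forall fun x => ?_))
  rw [Real.norm_of_nonneg (sq_nonneg _)]
  exact sq_comp_mul_le hL hs x

theorem sq_gaussianExp_le {f : ℝ → ℝ} (hf : MemLp f 2 (gaussianReal 0 1)) :
    gaussianExp f ^ 2 ≤ gaussianExp (fun x => f x ^ 2) := by
  have hvar := variance_nonneg f (gaussianReal 0 1)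
  rw [variance_eq_sub hf] at hvar
  exact sub_nonneg.mp hvar

theorem gaussianExp_sq_comp_mul_le (hσ : Measurable σ) (hL : ∀ t, |σ t| ≤ L * |t| ^ p)
    (hp : 0 < p) (hs : 0 ≤ s) (hv : L * s ^ p ≤ r * |v|) :
    gaussianExp (fun x => σ (s * x) ^ 2) ≤
      r ^ 2 * v ^ 2 * gaussianExp (fun x => |x| ^ (2 * p)) := by
  rw [gaussianExp, gaussianExp, ← integral_const_mul]
  exact integral_mono (memLp_two_comp_mul hσ hL hp hs).integrable_sq
    ((integrable_abs_rpow_gaussianReal (by positivity)).const_mul _)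
    fun x => sq_comp_mul_le_of_le hL hs hv x

theorem gaussianKappa_mul_rpow_le (ha : 0 < a) (hs : s ∈ Set.Icc a b) :
    gaussianKappa σ q a b * s ^ q ≤ |gaussianExp (fun x => σ (s * x))| := by
  have hs0 : 0 < s := ha.trans_le hs.1
  rw [← le_div_iff₀ (by positivity)]
  refine ciInf_le (f := fun u : Set.Icc a b =>
    |gaussianExp (fun x => σ ((u : ℝ) * x))| / (u : ℝ) ^ q) ⟨0, ?_⟩ ⟨s, hs⟩
  rintro _ ⟨u, rfl⟩
  exact div_nonneg (abs_nonneg _) (Real.rpow_nonneg (ha.le.trans u.2.1) _)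

theorem gaussianExp_comp_mul_ne_zero (ha : 0 < a) (hκ : 0 < gaussianKappa σ q a b)
    (hs : s ∈ Set.Icc a b) : gaussianExp (fun x => σ (s * x)) ≠ 0 := by
  have hs0 : 0 < s := ha.trans_le hs.1
  exact abs_pos.mp ((by positivity : 0 < gaussianKappa σ q a b * s ^ q).trans_le
    (gaussianKappa_mul_rpow_le ha hs))

theorem rpow_le_iSup_Icc (ha : 0 < a) (hs : s ∈ Set.Icc a b) (y : ℝ) :
    s ^ y ≤ ⨆ u : Set.Icc a b, (u : ℝ) ^ y := by
  have hcont : ContinuousOn (fun u : ℝ => u ^ y) (Set.Icc a b) := fun u hu =>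
    (Real.continuousAt_rpow_const u y (Or.inl (ha.trans_le hu.1).ne')).continuousWithinAt
  have hbdd := (isCompact_Icc.image_of_continuousOn hcont).bddAbove
  rw [Set.image_eq_range] at hbdd
  exact le_ciSup (f := fun u : Set.Icc a b => (u : ℝ) ^ y) hbdd ⟨s, hs⟩

theorem mul_rpow_le_scaleRatio_mul (hL : ∀ t, |σ t| ≤ L * |t| ^ p) (ha : 0 < a)
    (hκ : 0 < gaussianKappa σ q a b) (hs : s ∈ Set.Icc a b) :
    L * s ^ p ≤ scaleRatio σ L p q a b * |gaussianExp (fun x => σ (s * x))| := by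
  have hs0 : 0 < s := ha.trans_le hs.1
  have hL0 : 0 ≤ L := nonneg_of_abs_le_mul_abs_rpow hL
  calc L * s ^ p
      = L / gaussianKappa σ q a b * s ^ (p - q) * (gaussianKappa σ q a b * s ^ q) := by
        rw [show s ^ p = s ^ (p - q) * s ^ q by rw [← Real.rpow_add hs0, sub_add_cancel]]
        field_simp
    _ ≤ L / gaussianKappa σ q a b * (⨆ u : Set.Icc a b, (u : ℝ) ^ (p - q)) *
        |gaussianExp (fun x => σ (s * x))| := by
        have hsup : 0 ≤ ⨆ u : Set.Icc a b, (u : ℝ) ^ (p - q) :=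
          Real.iSup_nonneg fun u => Real.rpow_nonneg (ha.le.trans u.2.1) _
        gcongr
        · exact rpow_le_iSup_Icc ha hs _
        · exact gaussianKappa_mul_rpow_le ha hs

theorem scaleRatio_pos (hL : ∀ t, |σ t| ≤ L * |t| ^ p) (ha : 0 < a) (hab : a ≤ b)
    (hκ : 0 < gaussianKappa σ q a b) : 0 < scaleRatio σ L p q a b := by
  have hmem : a ∈ Set.Icc a b := Set.left_mem_Icc.mpr hab
  have hL0 : 0 < L := by
    by_contra! hL0
    have hσ (t : ℝ) : σ t = 0 := abs_nonpos_iff.mp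
      ((hL t).trans (mul_nonpos_of_nonpos_of_nonneg hL0 (by positivity)))
    exact gaussianExp_comp_mul_ne_zero ha hκ hmem (by simp [gaussianExp, hσ])
  exact pos_of_mul_pos_left ((mul_pos hL0 (Real.rpow_pos_of_pos ha p)).trans_le
    (mul_rpow_le_scaleRatio_mul hL ha hκ hmem)) (abs_nonneg _)

theorem gaussianExp_sq_le_gaussianRatio_mul (hσ : Measurable σ) (hL : ∀ t, |σ t| ≤ L * |t| ^ p)
    (hp : 0 < p) (ha : 0 < a) (hκ : 0 < gaussianKappa σ q a b) (hs : s ∈ Set.Icc a b) :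
    gaussianExp (fun x => σ (s * x) ^ 2) ≤
      gaussianRatio σ a b * gaussianExp (fun x => σ (s * x)) ^ 2 := by
  have hsq {u : ℝ} (hu : u ∈ Set.Icc a b) : 0 < gaussianExp (fun x => σ (u * x)) ^ 2 :=
    sq_pos_of_ne_zero (gaussianExp_comp_mul_ne_zero ha hκ hu)
  rw [← div_le_iff₀ (hsq hs)]
  refine le_ciSup (f := fun u : Set.Icc a b => gaussianExp (fun x => σ ((u : ℝ) * x) ^ 2) /
    gaussianExp (fun x => σ ((u : ℝ) * x)) ^ 2)
    ⟨scaleRatio σ L p q a b ^ 2 * gaussianExp (fun x => |x| ^ (2 * p)), ?_⟩ ⟨s, hs⟩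
  rintro _ ⟨⟨u, hu⟩, rfl⟩
  simp only
  rw [div_le_iff₀ (hsq hu), mul_right_comm]
  exact gaussianExp_sq_comp_mul_le hσ hL hp (ha.le.trans hu.1)
    (mul_rpow_le_scaleRatio_mul hL ha hκ hu)

end Activation

section PostActivation

variable {Ω : Type*} [MeasurableSpace Ω] {P : Measure Ω} {m d n : ℕ}
  {W : Ω → Matrix (Fin m) (Fin d) ℝ} {X : Matrix (Fin d) (Fin n) ℝ} {σ : ℝ → ℝ}
  {L p r ε θ B : ℝ}

/-- The mean `v_t = E[σ(s_t γ)]` of the entries in column `t` of `σ(WX)`. -/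
noncomputable def activationMean (σ : ℝ → ℝ) (X : Matrix (Fin d) (Fin n) ℝ) (t : Fin n) : ℝ :=
  gaussianExp (fun x => σ (preactivationScale X t * x))

/-- The second moment `E[σ(s_t γ)^2]` of the entries in column `t` of `σ(WX)`. -/
noncomputable def activationSecondMoment (σ : ℝ → ℝ) (X : Matrix (Fin d) (Fin n) ℝ)
    (t : Fin n) : ℝ :=
  gaussianExp (fun x => σ (preactivationScale X t * x) ^ 2)

theorem mixedTailExponent_div {β : ℝ} (m : ℝ) (hε : 0 ≤ ε) (hr : 0 ≤ r) :
    mixedTailExponent m β (ε / r) =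
      min (m * ε ^ 2 * r ^ (-2 : ℤ)) (m ^ min 1 β * ε ^ β * r ^ (-β)) := by
  rw [mixedTailExponent, div_pow, Real.div_rpow hε hr, Real.rpow_neg hr, zpow_neg]
  simp only [div_eq_mul_inv, mul_assoc]
  rfl

theorem mixedTailExponent_div_sq {β : ℝ} (m : ℝ) (hε : 0 ≤ ε) (hr : 0 ≤ r) :
    mixedTailExponent m β (ε / r ^ 2) =
      min (m * ε ^ 2 * r ^ (-4 : ℤ)) (m ^ min 1 β * ε ^ β * r ^ (-(2 * β))) := by
  have hzpow : (r ^ 2) ^ (-2 : ℤ) = r ^ (-4 : ℤ) := by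
    rw [← zpow_natCast, ← zpow_mul]
    norm_num
  have hrpow : (r ^ 2) ^ (-β) = r ^ (-(2 * β)) := by
    rw [← Real.rpow_natCast_mul hr, Nat.cast_ofNat, mul_neg]
  rw [mixedTailExponent_div m hε (sq_nonneg r), hzpow, hrpow]

namespace IsGaussianWeight

theorem measureReal_sum_mulVec_le (hW : IsGaussianWeight W P) (hX : ∀ t, X.col t ≠ 0)
    (hσ : Measurable σ) (hL : ∀ t, |σ t| ≤ L * |t| ^ p)
    (hγ : HasSubWeibullMoment (fun x => |x| ^ p) (min 1 (2 / p)) θ B (gaussianReal 0 1))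
    (hp : 0 < p) (hθ : 0 < θ) (hr : 0 < r)
    (hLr : ∀ t, L * preactivationScale X t ^ p ≤ r * |activationMean σ X t|)
    (hv : 0 < ∑ t, activationMean σ X t ^ 2) (hε : 0 < ε) (hε1 : p < 2 → ε ≤ 1) :
    P.real {ω | ∑ i, (postActivation σ (W ω) X).mulVec (activationMean σ X) i ≤
        m * ((1 - ε) * ∑ t, activationMean σ X t ^ 2)} ≤
      2 * Real.exp (-(rowStatisticRate p θ B * min (m * ε ^ 2 * r ^ (-2 : ℤ))
        (m ^ min 1 (2 / p) * ε ^ (2 / p) * r ^ (-(2 / p))))) := by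
  have := hW.indep.isProbabilityMeasure
  set v := activationMean σ X
  set S := ∑ t, v t ^ 2
  have hmean : ∑ t, gaussianExp (fun x => -(v t * σ (preactivationScale X t * x))) = -S := by
    rw [← Finset.sum_neg_distrib]
    refine Finset.sum_congr rfl fun t _ => ?_
    rw [gaussianExp, integral_neg, integral_const_mul, sq]
    rfl
  have htail := hW.measureReal_le_sum_rowStatistic_sub_le (f := fun t x => -(v t * σ x))
    (C := fun t => r * v t ^ 2) (ε := ε * S) hX (fun t => (hσ.const_mul _).neg) hγ hp hθ
    (fun t => by positivity) (by rw [← Finset.mul_sum]; positivity)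
    (fun t x => by
      rw [abs_neg]
      exact abs_mul_comp_mul_le hL (preactivationScale_pos (hX t)).le (hLr t) x)
    (by positivity)
    (fun h => by
      rw [hmean, abs_neg, abs_of_pos hv]
      exact mul_le_of_le_one_left hv.le (hε1 h))
  rw [hmean, ← Finset.mul_sum, mul_div_mul_right _ _ hv.ne',
    mixedTailExponent_div _ hε.le hr.le] at htail
  have hrow (ω : Ω) (i : Fin m) : ∑ t, -(v t * σ ((W ω * X) i t)) - -S =
      S - (postActivation σ (W ω) X).mulVec v i := by
    simp only [Matrix.mulVec, dotProduct, postActivation, Matrix.map_apply,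
      Finset.sum_neg_distrib, mul_comm (v _)]
    ring
  simp only [hrow, Finset.sum_sub_distrib, Finset.sum_const, Finset.card_univ, Fintype.card_fin,
    nsmul_eq_mul] at htail
  refine (measureReal_mono fun ω hω => ?_).trans htail
  rw [Set.mem_ofPred_eq] at hω ⊢
  linarith

theorem measureReal_le_sum_sq (hW : IsGaussianWeight W P) (hX : ∀ t, X.col t ≠ 0)
    (hσ : Measurable σ) (hL : ∀ t, |σ t| ≤ L * |t| ^ p)
    (hγ : HasSubWeibullMoment (fun x => |x| ^ (2 * p)) (min 1 (2 / (2 * p))) θ B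
      (gaussianReal 0 1))
    (hp : 0 < p) (hθ : 0 < θ) (hr : 0 < r)
    (hLr : ∀ t, L * preactivationScale X t ^ p ≤ r * |activationMean σ X t|)
    (hv : 0 < ∑ t, activationMean σ X t ^ 2) (hε : 0 < ε) (hε1 : p < 1 → ε ≤ 1) :
    P.real {ω | m * ((1 + ε) * ∑ t, activationSecondMoment σ X t) ≤
        ∑ i, ∑ t, postActivation σ (W ω) X i t ^ 2} ≤
      2 * Real.exp (-(rowStatisticRate (2 * p) θ B * min (m * ε ^ 2 * r ^ (-4 : ℤ))
        (m ^ min 1 (1 / p) * ε ^ (1 / p) * r ^ (-(2 / p))))) := by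
  have := hW.indep.isProbabilityMeasure
  set e := activationSecondMoment σ X
  have hs (t : Fin n) : 0 ≤ preactivationScale X t := (preactivationScale_pos (hX t)).le
  have hve (t : Fin n) : activationMean σ X t ^ 2 ≤ e t :=
    sq_gaussianExp_le (memLp_two_comp_mul hσ hL hp (hs t))
  have hE : 0 < ∑ t, e t := hv.trans_le (Finset.sum_le_sum fun t _ => hve t)
  have hmean :
      ∑ t, gaussianExp (fun x => σ (preactivationScale X t * x) ^ 2) = ∑ t, e t := rfl
  have htail := hW.measureReal_le_sum_rowStatistic_sub_le (f := fun _ x => σ x ^ 2)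
    (C := fun t => r ^ 2 * e t) (ε := ε * ∑ t, e t) hX (fun _ => hσ.pow_const 2) hγ
    (by positivity) hθ (fun t => mul_nonneg (sq_nonneg r) ((sq_nonneg _).trans (hve t)))
    (by rw [← Finset.mul_sum]; positivity)
    (fun t x => by
      rw [abs_of_nonneg (sq_nonneg _)]
      exact (sq_comp_mul_le_of_le hL (hs t) (hLr t) x).trans (mul_le_mul_of_nonneg_right
        (mul_le_mul_of_nonneg_left (hve t) (sq_nonneg r)) (by positivity)))
    (by positivity)
    (fun h => (mul_le_of_le_one_left hE.le (hε1 (by linarith))).trans (le_abs_self _))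
  rw [hmean, ← Finset.mul_sum, mul_div_mul_right _ _ hE.ne',
    mixedTailExponent_div_sq _ hε.le hr.le, show 2 / (2 * p) = 1 / p by field_simp,
    mul_one_div] at htail
  refine (measureReal_mono fun ω hω => ?_).trans htail
  simp only [postActivation, Matrix.map_apply, Set.mem_ofPred_eq, Finset.sum_sub_distrib,
    Finset.sum_const, Finset.card_univ, Fintype.card_fin, nsmul_eq_mul] at hω ⊢
  linarith

theorem one_sub_le_measureReal_stableRank_le [Nonempty (Fin n)] {q ε₁ ε₂ θ₁ θ₂ B₁ B₂ : ℝ}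
    (hW : IsGaussianWeight W P) (hX : ∀ t, X.col t ≠ 0) (hσ : Measurable σ)
    (hL : ∀ t, |σ t| ≤ L * |t| ^ p) (hp : 0 < p) (hθ₁ : 0 < θ₁) (hθ₂ : 0 < θ₂)
    (hγ₁ : HasSubWeibullMoment (fun x => |x| ^ (2 * p)) (min 1 (2 / (2 * p))) θ₁ B₁
      (gaussianReal 0 1))
    (hγ₂ : HasSubWeibullMoment (fun x => |x| ^ p) (min 1 (2 / p)) θ₂ B₂ (gaussianReal 0 1))
    (hκ : 0 < gaussianKappa σ q (minScale X) (maxScale X))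
    (hr : r = scaleRatio σ L p q (minScale X) (maxScale X))
    (hε₁ : 0 < ε₁) (hε₁1 : p < 1 → ε₁ ≤ 1) (hε₂ : 0 < ε₂) (hε₂1 : ε₂ < 1) :
    1 - 2 * Real.exp (-(rowStatisticRate p θ₂ B₂ * min (m * ε₂ ^ 2 * r ^ (-2 : ℤ))
            (m ^ min 1 (2 / p) * ε₂ ^ (2 / p) * r ^ (-(2 / p)))))
        - 2 * Real.exp (-(rowStatisticRate (2 * p) θ₁ B₁ * min (m * ε₁ ^ 2 * r ^ (-4 : ℤ))
            (m ^ min 1 (1 / p) * ε₁ ^ (1 / p) * r ^ (-(2 / p))))) ≤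
      P.real {ω | postActivation σ (W ω) X ≠ 0 ∧ stableRank (postActivation σ (W ω) X) ≤
        (1 + ε₁) / (1 - ε₂) ^ 2 * gaussianRatio σ (minScale X) (maxScale X)} := by
  have := hW.indep.isProbabilityMeasure
  have ha : 0 < minScale X := minScale_pos hX
  have hmem (t : Fin n) := preactivationScale_mem_Icc X t
  have hr0 : 0 < r := hr ▸ scaleRatio_pos hL ha (minScale_le_maxScale X) hκ
  have hLr (t : Fin n) : L * preactivationScale X t ^ p ≤ r * |activationMean σ X t| :=
    hr ▸ mul_rpow_le_scaleRatio_mul hL ha hκ (hmem t)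
  have hv : 0 < ∑ t, activationMean σ X t ^ 2 := Finset.sum_pos
    (fun t _ => sq_pos_of_ne_zero (gaussianExp_comp_mul_ne_zero ha hκ (hmem t)))
    Finset.univ_nonempty
  have hlow := hW.measureReal_sum_mulVec_le hX hσ hL hγ₂ hp hθ₂ hr0 hLr hv hε₂ fun _ => hε₂1.le
  have hup := hW.measureReal_le_sum_sq hX hσ hL hγ₁ hp hθ₁ hr0 hLr hv hε₁ hε₁1
  have hsecond : ∑ t, activationSecondMoment σ X t ≤
      gaussianRatio σ (minScale X) (maxScale X) * ∑ t, activationMean σ X t ^ 2 := by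
    rw [Finset.mul_sum]
    exact Finset.sum_le_sum fun t _ => gaussianExp_sq_le_gaussianRatio_mul hσ hL hp ha hκ (hmem t)
  refine (sub_le_sub (sub_le_sub_left hlow 1) hup).trans
    (one_sub_sub_le_measureReal fun ω hlowω hupω => ?_)
  rw [Set.mem_ofPred_eq, not_le] at hlowω hupω
  rw [Set.mem_ofPred_eq, div_mul_eq_mul_div]
  refine ne_zero_and_stableRank_le hv (sub_pos.mpr hε₂1) hlowω (hupω.le.trans ?_)
  rw [mul_assoc]
  gcongr

end IsGaussianWeight

end PostActivation

theorem relu_mul_of_nonneg {s : ℝ} (hs : 0 ≤ s) (x : ℝ) : relu (s * x) = s * relu x := by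
  rw [relu, relu, mul_max_of_nonneg _ _ hs, mul_zero]

theorem integral_relu_pow_gaussianReal {k : ℕ} (hk : k ≠ 0) :
    ∫ x, relu x ^ k ∂(gaussianReal 0 1) =
      (√(2 * Real.pi))⁻¹ * ((1 / 2) ^ (-((k : ℝ) + 1) / 2) * (1 / 2) *
        Real.Gamma (((k : ℝ) + 1) / 2)) := by
  rw [integral_gaussianReal_eq_integral_smul one_ne_zero,
    ← integral_rpow_mul_exp_neg_mul_rpow (p := 2) (q := k) (b := 1 / 2) (by norm_num)
      (by linarith [(Nat.cast_nonneg k : (0 : ℝ) ≤ k)]) (by norm_num),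
    ← integral_const_mul, ← integral_indicator measurableSet_Ioi]
  congr 1
  ext x
  by_cases hx : 0 < x
  · rw [Set.indicator_of_mem (Set.mem_Ioi.mpr hx)]
    simp only [gaussianPDFReal, relu, max_eq_left hx.le, smul_eq_mul, Real.rpow_natCast,
      Real.rpow_two, NNReal.coe_one, mul_one, sub_zero]
    ring_nf
  · rw [Set.indicator_of_notMem (by simpa using hx)]
    simp [relu, max_eq_right (not_lt.mp hx), hk]

theorem gaussianExp_relu : gaussianExp relu = (√(2 * Real.pi))⁻¹ := by
  have h := integral_relu_pow_gaussianReal one_ne_zero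
  simp only [pow_one, Nat.cast_one] at h
  rw [gaussianExp, h]
  norm_num [Real.rpow_neg_one]

theorem gaussianExp_relu_sq : gaussianExp (fun x => relu x ^ 2) = 1 / 2 := by
  have hGamma : Real.Gamma ((2 + 1) / 2) = 1 / 2 * √Real.pi := by
    rw [show ((2 + 1) / 2 : ℝ) = 1 / 2 + 1 by norm_num, Real.Gamma_add_one (by norm_num),
      Real.Gamma_one_half_eq]
  have hpow : ((1 : ℝ) / 2) ^ (-(2 + 1) / 2 : ℝ) = 2 * √2 := by
    rw [show (-(2 + 1) / 2 : ℝ) = -(1 + 1 / 2) by norm_num, one_div,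
      Real.rpow_neg_eq_inv_rpow, inv_inv, Real.rpow_add two_pos, Real.rpow_one,
      ← one_div, ← Real.sqrt_eq_rpow]
  rw [gaussianExp, integral_relu_pow_gaussianReal two_ne_zero, Nat.cast_ofNat, hGamma, hpow,
    Real.sqrt_mul zero_le_two]
  field_simp

theorem gaussianRatio_relu {a b : ℝ} (ha : 0 < a) (hab : a ≤ b) :
    gaussianRatio relu a b = Real.pi := by
  have : Nonempty (Set.Icc a b) := Set.nonempty_Icc_subtype hab
  have hratio (s : Set.Icc a b) : gaussianExp (fun x => relu ((s : ℝ) * x) ^ 2) /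
      gaussianExp (fun x => relu ((s : ℝ) * x)) ^ 2 = Real.pi := by
    have hs : (0 : ℝ) < s := ha.trans_le s.2.1
    have hone : gaussianExp (fun x => s * relu x) = s * gaussianExp relu :=
      integral_const_mul _ _
    have htwo : gaussianExp (fun x => (s : ℝ) ^ 2 * relu x ^ 2) =
        (s : ℝ) ^ 2 * gaussianExp (fun x => relu x ^ 2) := integral_const_mul _ _
    simp only [relu_mul_of_nonneg hs.le, mul_pow]
    rw [hone, htwo, gaussianExp_relu, gaussianExp_relu_sq, mul_pow, inv_pow,
      Real.sq_sqrt (by positivity)]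
    field_simp
  simp only [gaussianRatio, hratio, ciSup_const]

theorem mainTheorem1_general {p : ℝ} (hp : 0 < p) : ∃ c : ℝ, 0 < c ∧
    ∀ (m d n : ℕ) (_ : 0 < n) (X : Matrix (Fin d) (Fin n) ℝ) (_ : ∀ t, X.col t ≠ 0)
      (Ω : Type*) [MeasurableSpace Ω] (P : Measure Ω)
      (W : Ω → Matrix (Fin m) (Fin d) ℝ) (_ : IsGaussianWeight W P)
      (σ : ℝ → ℝ) (_ : Measurable σ) (L : ℝ) (_ : ∀ t, |σ t| ≤ L * |t| ^ p)
      (a b : ℝ) (_ : a = minScale X) (_ : b = maxScale X)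
      (q : ℝ) (_ : 0 < gaussianKappa σ q a b) (r : ℝ) (_ : r = scaleRatio σ L p q a b)
      (ε₁ ε₂ : ℝ) (_ : 0 < ε₁) (_ : p < 1 → ε₁ ≤ 1) (_ : 0 < ε₂) (_ : ε₂ < 1),
      1 - 2 * Real.exp (-(c * min ((m : ℝ) * ε₂ ^ 2 * r ^ (-2 : ℤ))
              ((m : ℝ) ^ (min 1 (2 / p)) * ε₂ ^ (2 / p) * r ^ (-(2 / p)))))
        - 2 * Real.exp (-(c * min ((m : ℝ) * ε₁ ^ 2 * r ^ (-4 : ℤ))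
              ((m : ℝ) ^ (min 1 (1 / p)) * ε₁ ^ (1 / p) * r ^ (-(2 / p)))))
        ≤ P.real {ω | postActivation σ (W ω) X ≠ 0 ∧
            stableRank (postActivation σ (W ω) X)
              ≤ (1 + ε₁) / (1 - ε₂) ^ 2 * gaussianRatio σ a b} := by
  have hp2 : 0 < 2 * p := by positivity
  obtain ⟨θ₁, B₁, hθ₁, hγ₁⟩ := exists_hasSubWeibullMoment_abs_rpow_gaussianReal hp2
  obtain ⟨θ₂, B₂, hθ₂, hγ₂⟩ := exists_hasSubWeibullMoment_abs_rpow_gaussianReal hp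
  refine ⟨min (rowStatisticRate (2 * p) θ₁ B₁) (rowStatisticRate p θ₂ B₂),
    lt_min (rowStatisticRate_pos hγ₁ hp2 hθ₁) (rowStatisticRate_pos hγ₂ hp hθ₂), ?_⟩
  rintro m d n hn X hX Ω _ P W hW σ hσ L hL _ _ rfl rfl q hκ r hr ε₁ ε₂ hε₁ hε₁1 hε₂ hε₂1
  have : Nonempty (Fin n) := Fin.pos_iff_nonempty.mp hn
  have hr0 : 0 ≤ r := (hr ▸ scaleRatio_pos hL (minScale_pos hX)
    (minScale_le_maxScale X) hκ : 0 < r).le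
  refine le_trans ?_ (hW.one_sub_le_measureReal_stableRank_le hX hσ hL hp hθ₁ hθ₂ hγ₁ hγ₂ hκ hr
    hε₁ hε₁1 hε₂ hε₂1)
  gcongr
  · exact min_le_right _ _
  · exact min_le_left _ _

theorem mainTheorem1 :
    (∀ p : ℝ, 1 ≤ p → ∃ c : ℝ, 0 < c ∧
      ∀ (m d n : ℕ) (_ : 0 < n) (X : Matrix (Fin d) (Fin n) ℝ) (_ : ∀ t, X.col t ≠ 0)
        (Ω : Type*) [MeasurableSpace Ω] (P : Measure Ω) [IsProbabilityMeasure P]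
        (W : Ω → Matrix (Fin m) (Fin d) ℝ) (_ : IsGaussianWeight W P)
        (σ : ℝ → ℝ) (_ : Measurable σ) (_ : σ 0 = 0)
        (L : ℝ) (_ : ∀ t, |σ t| ≤ L * |t| ^ p)
        (a b : ℝ) (_ : a = minScale X) (_ : b = maxScale X)
        (q : ℝ) (_ : 0 < q) (_ : 0 < gaussianKappa σ q a b)
        (r : ℝ) (_ : r = scaleRatio σ L p q a b)
        (ε₁ ε₂ : ℝ) (_ : 0 < ε₁) (_ : ε₁ ≤ 1) (_ : 0 < ε₂) (_ : ε₂ < 1),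
        1 - 2 * Real.exp (-(c * min ((m : ℝ) * ε₂ ^ 2 * r ^ (-2 : ℤ))
                ((m : ℝ) ^ (min 1 (2 / p)) * ε₂ ^ (2 / p) * r ^ (-(2 / p)))))
          - 2 * Real.exp (-(c * min ((m : ℝ) * ε₁ ^ 2 * r ^ (-4 : ℤ))
                ((m : ℝ) ^ (min 1 (1 / p)) * ε₁ ^ (1 / p) * r ^ (-(2 / p)))))
          ≤ P.real {ω | postActivation σ (W ω) X ≠ 0 ∧
              stableRank (postActivation σ (W ω) X)
                ≤ (1 + ε₁) / (1 - ε₂) ^ 2 * gaussianRatio σ a b}) ∧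
    (∀ a b : ℝ, 0 < a → a ≤ b → gaussianRatio relu a b = Real.pi) := by
  refine ⟨fun p hp => ?_, fun _ _ => gaussianRatio_relu⟩
  obtain ⟨c, hc, h⟩ := mainTheorem1_general (zero_lt_one.trans_le hp)
  exact ⟨c, hc, fun m d n hn X hX Ω _ P _ W hW σ hσ _ L hL a b ha hb q _ hκ r hr ε₁ ε₂ hε₁ hε₁1 =>
    h m d n hn X hX Ω P W hW σ hσ L hL a b ha hb q hκ r hr ε₁ ε₂ hε₁ fun _ => hε₁1⟩
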